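/- Fix integers $n,m,T\ge 0$, an encoder pair $A\in\mathbb R^{(n+1)\times(n+1)}$, $C\in\mathbb R^{1\times(n+1)}$, and a channel with state-space parameters $F\in\mathbb R^{m\times m}$, $G\in\mathbb R^{m\times 1}$, $H\in\mathbb R^{1\times m}$ (no further assumption on these matrices is needed). Let $W\sim\mathcal N(0,I_{n+1})$ and let $N_0,N_1,\dots$ be i.i.d. $\mathcal N(0,1)$, independent of $W$. Primes denote transposes, $z^T:=(z_0,\dots,z_T)$, and logarithms and mutual information are in nats. The source is $r_t=CA^tW$. The channel maps an input $(u_t)$ to the output $y_t=Hs_t+u_t+N_t$, where $s_0=0$ and $s_{t+1}=Fs_t+Gu_t$. Put $$\mathbb A=\begin{pmatrix}A&0\\ GC&F\end{pmatrix},\quad \mathbb C=(C\ \ H),\quad \mathbb D=(C\ \ 0),\quad \Sigma_0=\begin{pmatrix}I_{n+1}&0\\0&0\end{pmatrix},$$ $$\Sigma_{t+1}=\mathbb A\Sigma_t\mathbb A'-\frac{\mathbb A\Sigma_t\mathbb C'\mathbb C\Sigma_t\mathbb A'}{\mathbb C\Sigma_t\mathbb C'+1},\qquad L_t=\begin{pmatrix}L_{1,t}\\L_{2,t}\end{pmatrix}=\frac{\mathbb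 A\Sigma_t\mathbb C'}{\mathbb C\Sigma_t\mathbb C'+1}.$$ *Coding system.* With $x_0=W$, $s_0=0$, $\hat x_0=0$, $\hat s_0=0$, let $x_{t+1}=Ax_t$, $u_t=Cx_t-C\hat x_t$, $s_{t+1}=Fs_t+Gu_t$, $y_t=Hs_t+u_t+N_t$, $e_t=y_t-H\hat s_t$, $\hat x_{t+1}=A\hat x_t+L_{1,t}e_t$, $\hat s_{t+1}=F\hat s_t+L_{2,t}e_t$. Let $\mathbb X_t=\begin{pmatrix}x_t-\hat x_t\\ s_t-\hat s_t\end{pmatrix}$, let $K_e^{(T)}$ be the covariance matrix of $e^T$, and let $K_{e,t}=\mathbf E\,e_t^2$. *Estimation system.* Let $\bar y_t$ be the channel output when the input is $r_t$ itself (no feedback). Let $\mathrm{MMSE}_{W,t}$ be the minimum mean-square error matrix of $W$ given $\bar y_0,\dots,\bar y_t$, i.e. the error covariance of the conditional mean, with $\mathrm{MMSE}_{W,-1}=I_{n+1}$. Let $\mathrm{CMMSE}_{r,T}$ be the error covariance matrix of $r^T$ when each $r_t$ is estimated by its conditional mean given $\bar y_0,\dots,\bar y_{t-1}$. Let $p$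 be the positive $C^1$ joint Lebesgue density of $(W,\bar y^T)$ (it exists and is unique), $\mathcal I_{W,T}=\mathbf E\big[\nabla_w\log p(W,\bar y^T)\,\nabla_w\log p(W,\bar y^T)'\big]$ the Bayesian Fisher information matrix, and $\mathrm{CRB}_{W,T}=\mathcal I_{W,T}^{-1}$ the Bayesian Cramér–Rao bound. *General feedback.* For a strictly lower triangular $\mathcal G\in\mathbb R^{(T+1)\times(T+1)}$, let the channel be driven by $u^T=r^T+\mathcal G y^T$. Let $P_{T,n}(A,C)$ be the infimum over all such $\mathcal G$ of $\frac1{T+1}\mathbf E\,\|u^T\|^2$. Then $\mathbf E\,\mathbb X_t\mathbb X_t'=\Sigma_t$ for all $t\ge0$, and the following hold. (i) $I(W;y^T)$ is finite, has the same value for the coding system and for every strictly lower triangular feedback $\mathcal G$, the matrices $\mathrm{MMSE}_{W,T}$ and $\mathcal I_{W,T}$ are positive definite, and $$I(W;y^T)=\tfrac12\log\det K_e^{(T)}=\tfrac12\sum_{t=0}^T\log K_{e,t}=\tfrac12\sum_{t=0}^T\log(\mathbb C\Sigma_t\mathbb C'+1)$$ $$=\tfrac12\log\det\mathrm{MMSE}_{W,T}^{-1}=\tfrac12\log\det\mathcal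 I_{W,T}=\tfrac12\log\det\mathrm{CRB}_{W,T}^{-1}.$$ (ii) The infimum $P_{T,n}(A,C)$ is attained, it equals the average input power $\frac1{T+1}\sum_{t=0}^T\mathbf E\,u_t^2$ of the coding system, and $$P_{T,n}(A,C)=\frac1{T+1}\sum_{t=0}^T\mathbb D\Sigma_t\mathbb D'=\frac1{T+1}\operatorname{trace}(\mathrm{CMMSE}_{r,T})=\frac1{T+1}\sum_{t=0}^T CA^t\,\mathrm{MMSE}_{W,t-1}\,(A^t)'C'.$$ -/

import Mathlib

open MeasureTheory ProbabilityTheory Matrix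

namespace FeedbackCoding

noncomputable section

/-- The constant parameters of the coding system: the encoder pair `(A, C)` of dimension `n + 1`,
and the state-space realization `(F, G, H, 1)` of the channel, of dimension `m`.  The row vectors
`C`, `H` and the column vector `G` are stored as plain vectors. -/
structure Params (n m : ℕ) where
  A : Matrix (Fin (n + 1)) (Fin (n + 1)) ℝ
  C : Fin (n + 1) → ℝ
  F : Matrix (Fin m) (Fin m) ℝ
  G : Fin m → ℝ
  H : Fin m → ℝ

namespace Params

variable {n m : ℕ} (S : Params n m)

/-! ### The Riccati recursion and the Kalman gains -/

/-- The block matrix `[A 0; G C F]`. -/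
def bigA : Matrix (Fin (n + 1) ⊕ Fin m) (Fin (n + 1) ⊕ Fin m) ℝ :=
  Matrix.fromBlocks S.A 0 (Matrix.vecMulVec S.G S.C) S.F

/-- The row vector `[C H]`. -/
def bigC : Fin (n + 1) ⊕ Fin m → ℝ := Sum.elim S.C S.H

/-- The row vector `[C 0]`. -/
def bigD : Fin (n + 1) ⊕ Fin m → ℝ := Sum.elim S.C 0

/-- The Riccati recursion, started at `diag(I, 0)`. -/
def ric : ℕ → Matrix (Fin (n + 1) ⊕ Fin m) (Fin (n + 1) ⊕ Fin m) ℝ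
  | 0 => Matrix.fromBlocks 1 0 0 0
  | t + 1 =>
      S.bigA * ric t * S.bigAᵀ -
        (S.bigC ⬝ᵥ (ric t *ᵥ S.bigC) + 1)⁻¹ •
          Matrix.vecMulVec ((S.bigA * ric t) *ᵥ S.bigC) (S.bigC ᵥ* (ric t * S.bigAᵀ))

/-- The Kalman gain: the stacked vector with blocks `L₁` (encoder state) and `L₂` (channel state)
at time `t`. -/
def gain (t : ℕ) : Fin (n + 1) ⊕ Fin m → ℝ :=
  (S.bigC ⬝ᵥ (S.ric t *ᵥ S.bigC) + 1)⁻¹ • ((S.bigA * S.ric t) *ᵥ S.bigC)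

/-! ### The signals, for a given message `w` and a given noise path `ν` -/

/-- The source signal `r t = C x t`, where `x 0 = w` and `x (t + 1) = A x t`. -/
def source (w : Fin (n + 1) → ℝ) (t : ℕ) : ℝ := S.C ⬝ᵥ ((S.A ^ t) *ᵥ w)

/-- The channel state in the absence of feedback, when the channel input is the source signal. -/
def openState (w : Fin (n + 1) → ℝ) : ℕ → (Fin m → ℝ)
  | 0 => 0
  | t + 1 => S.F *ᵥ openState w t + S.source w t • S.G

/-- The observation of the estimation system: the channel output in the absence of feedback. -/
def openOutput (w : Fin (n + 1) → ℝ) (ν : ℕ → ℝ) (t : ℕ) : ℝ :=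
  S.H ⬝ᵥ S.openState w t + S.source w t + ν t

end Params

/-- The joint state of the coding system with the Kalman filter as feedback generator: encoder
state `x`, channel state `s`, and their estimates. -/
structure LoopState (n m : ℕ) where
  x : Fin (n + 1) → ℝ
  s : Fin m → ℝ
  xhat : Fin (n + 1) → ℝ
  shat : Fin m → ℝ

namespace LoopState

variable {n m : ℕ} (S : Params n m) (z : LoopState n m)

/-- The channel input `u = r - rhat = C x - C xhat`. -/
def input : ℝ := S.C ⬝ᵥ z.x - S.C ⬝ᵥ z.xhat

/-- The channel output `y = H s + u + N`. -/
def output (noise : ℝ) : ℝ := S.H ⬝ᵥ z.s + z.input S + noise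

/-- The innovation `e = y - H shat`. -/
def innov (noise : ℝ) : ℝ := z.output S noise - S.H ⬝ᵥ z.shat

/-- The stacked estimation error `(x - xhat, s - shat)`. -/
def error : Fin (n + 1) ⊕ Fin m → ℝ := Sum.elim (z.x - z.xhat) (z.s - z.shat)

/-- One step of the coding system, with gain `L` and channel noise `noise`. -/
def step (L : Fin (n + 1) ⊕ Fin m → ℝ) (noise : ℝ) : LoopState n m where
  x := S.A *ᵥ z.x
  s := S.F *ᵥ z.s + z.input S • S.G
  xhat := S.A *ᵥ z.xhat + z.innov S noise • (fun i => L (Sum.inl i))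
  shat := S.F *ᵥ z.shat + z.innov S noise • (fun j => L (Sum.inr j))

end LoopState

namespace Params

variable {n m : ℕ} (S : Params n m)

/-- The trajectory of the coding system with Kalman-filter feedback. -/
def loop (w : Fin (n + 1) → ℝ) (ν : ℕ → ℝ) : ℕ → LoopState n m
  | 0 => ⟨w, 0, 0, 0⟩
  | t + 1 => (loop w ν t).step S (S.gain t) (ν t)

/-- The channel input of the coding system with Kalman-filter feedback. -/
def kalmanInput (w : Fin (n + 1) → ℝ) (ν : ℕ → ℝ) (t : ℕ) : ℝ := (S.loop w ν t).input S

/-- The channel output of the coding system with Kalman-filter feedback. -/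
def kalmanOutput (w : Fin (n + 1) → ℝ) (ν : ℕ → ℝ) (t : ℕ) : ℝ :=
  (S.loop w ν t).output S (ν t)

/-- The innovation of the coding system with Kalman-filter feedback. -/
def kalmanInnov (w : Fin (n + 1) → ℝ) (ν : ℕ → ℝ) (t : ℕ) : ℝ := (S.loop w ν t).innov S (ν t)

/-- The estimation error of the coding system with Kalman-filter feedback. -/
def kalmanError (w : Fin (n + 1) → ℝ) (ν : ℕ → ℝ) (t : ℕ) : Fin (n + 1) ⊕ Fin m → ℝ :=
  (S.loop w ν t).error

/-! ### The general coding structure, with an arbitrary linear feedback generator -/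

/-- The lower triangular Toeplitz matrix of the impulse response `1, H G, H F G, H F² G, …` of the
channel, on the horizon `0, …, T`. -/
def chanMatrix (T : ℕ) : Matrix (Fin (T + 1)) (Fin (T + 1)) ℝ :=
  Matrix.of fun i j =>
    if i = j then 1
    else if j < i then S.H ⬝ᵥ ((S.F ^ ((i : ℕ) - (j : ℕ) - 1)) *ᵥ S.G)
    else 0

/-- The channel output vector under the feedback `u = r + K y`; it is the solution `y` of
`y = Z (r + K y) + N`, where `Z` is the channel matrix. -/
def fbOutput (T : ℕ) (K : Matrix (Fin (T + 1)) (Fin (T + 1)) ℝ)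
    (w : Fin (n + 1) → ℝ) (ν : ℕ → ℝ) : Fin (T + 1) → ℝ :=
  (1 - S.chanMatrix T * K)⁻¹ *ᵥ
    (S.chanMatrix T *ᵥ (fun t : Fin (T + 1) => S.source w t) + fun t : Fin (T + 1) => ν t)

/-- The channel input vector under the feedback `u = r + K y`. -/
def fbInput (T : ℕ) (K : Matrix (Fin (T + 1)) (Fin (T + 1)) ℝ)
    (w : Fin (n + 1) → ℝ) (ν : ℕ → ℝ) : Fin (T + 1) → ℝ :=
  (fun t : Fin (T + 1) => S.source w t) + K *ᵥ S.fbOutput T K w ν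

end Params

/-- Strictly lower triangular matrices: the strictly causal feedback generators. -/
def IsStrictlyLower {k : ℕ} (K : Matrix (Fin k) (Fin k) ℝ) : Prop :=
  ∀ i j, i ≤ j → K i j = 0

/-! ### Information and estimation quantities -/

section Stochastic

variable {Ω : Type*} [MeasurableSpace Ω] (μ : Measure Ω)

/-- The first `k` samples (at times `0, …, k - 1`) of a discrete-time process. -/
def firstSamples (Y : ℕ → Ω → ℝ) (k : ℕ) : Ω → Fin k → ℝ := fun ω t => Y t ω

/-- The average power `(1 / (T + 1)) E ‖u‖²` of a vector signal on the horizon `0, …, T`. -/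
def avgPower (T : ℕ) (u : Ω → Fin (T + 1) → ℝ) : ℝ :=
  (1 / ((T : ℝ) + 1)) * ∑ t, ∫ ω, (u ω t) ^ 2 ∂μ

/-- Mutual information in nats: the relative entropy of the joint law with respect to the product
of the marginal laws. -/
def mutualInfo {E E' : Type*} [MeasurableSpace E] [MeasurableSpace E']
    (X : Ω → E) (Y : Ω → E') : ENNReal :=
  InformationTheory.klDiv (μ.map fun ω => (X ω, Y ω)) ((μ.map X).prod (μ.map Y))

/-- The conditional mean of the real random variable `X` given the observation `Y`. -/
def condMean {E : Type*} [MeasurableSpace E] (X : Ω → ℝ) (Y : Ω → E) : Ω → ℝ :=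
  μ[X | MeasurableSpace.comap Y inferInstance]

/-- The minimum mean-square error matrix of the random vector `X` given the observation `Y`:
the error covariance matrix of the conditional-mean estimator. -/
def mmse {ι E : Type*} [MeasurableSpace E] (X : Ω → ι → ℝ) (Y : Ω → E) : Matrix ι ι ℝ :=
  Matrix.of fun i j =>
    ∫ ω, (X ω i - condMean μ (fun ω' => X ω' i) Y ω) *
      (X ω j - condMean μ (fun ω' => X ω' j) Y ω) ∂μ

/-- The (strictly) causal minimum mean-square error matrix of `(R 0, …, R T)`: the error covariance
matrix when each `R t` is estimated from `Y 0, …, Y (t - 1)`. -/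
def causalMmse (R Y : ℕ → Ω → ℝ) (T : ℕ) : Matrix (Fin (T + 1)) (Fin (T + 1)) ℝ :=
  Matrix.of fun i j =>
    ∫ ω, (R i ω - condMean μ (R i) (firstSamples Y i) ω) *
      (R j ω - condMean μ (R j) (firstSamples Y j) ω) ∂μ

/-- The covariance matrix of `(Y 0, …, Y T)`. -/
def covMatrix (Y : ℕ → Ω → ℝ) (T : ℕ) : Matrix (Fin (T + 1)) (Fin (T + 1)) ℝ :=
  Matrix.of fun i j => covariance (Y i) (Y j) μ

end Stochastic

section Fisher

variable {p q : ℕ}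

/-- `f` is a positive continuously differentiable Lebesgue density of the joint law `ρ`.  (For a
given `ρ` there is at most one such function.) -/
structure IsRegularDensity (ρ : Measure ((Fin p → ℝ) × (Fin q → ℝ)))
    (f : (Fin p → ℝ) × (Fin q → ℝ) → ℝ) : Prop where
  pos : ∀ z, 0 < f z
  contDiff : ContDiff ℝ 1 f
  law : ρ = (volume : Measure ((Fin p → ℝ) × (Fin q → ℝ))).withDensity
    fun z => ENNReal.ofReal (f z)

/-- The Bayesian score: the partial derivative of `log f (w, y)` in the `i`-th coordinate of the
parameter `w`. -/
def score (f : (Fin p → ℝ) × (Fin q → ℝ) → ℝ) (i : Fin p)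
    (z : (Fin p → ℝ) × (Fin q → ℝ)) : ℝ :=
  lineDeriv ℝ (fun w => Real.log (f (w, z.2))) z.1 (Pi.single i 1)

/-- The Bayesian Fisher information matrix of the parameter `w`, for the joint law `ρ` of parameter
and observation, with density `f`: the expected outer product of the score of the joint density. -/
def bayesFisher (ρ : Measure ((Fin p → ℝ) × (Fin q → ℝ)))
    (f : (Fin p → ℝ) × (Fin q → ℝ) → ℝ) : Matrix (Fin p) (Fin p) ℝ :=
  Matrix.of fun i j => ∫ z, score f i z * score f j z ∂ρ

/-- The Bayesian Cramér-Rao bound: the inverse of the Bayesian Fisher information matrix. -/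
def bayesCRB (ρ : Measure ((Fin p → ℝ) × (Fin q → ℝ)))
    (f : (Fin p → ℝ) × (Fin q → ℝ) → ℝ) : Matrix (Fin p) (Fin p) ℝ :=
  (bayesFisher ρ f)⁻¹

end Fisher

end

end FeedbackCoding

namespace FeedbackCoding

/-! ### Densities and relative entropy -/

section Density

/-! Every signal is a linear function of the standard Gaussian vector formed by `W` and finitely
many noise samples. Second moments are therefore inner products of coefficient vectors, uncorrelated
signals are independent, and a conditional mean is an orthogonal projection (`condMean_ae_eq`).

Causal equivalence. The filter states are linear combinations of past innovations, so at each time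
`ybar`, `y` and `e` differ only by elements of the span of the past of `e`. Hence the three
processes have the same `past` (`past_openOutput_eq`, `past_output_eq`), and on a finite horizon `e`
and `y` are unit lower triangular transforms of `ybar` (`exists_unitLower`). Any strictly causal
feedback also transforms `ybar` by an invertible matrix, and mutual information ignores such maps
(`mutualInfo_mulVec`).

Information. Write `ybar = B W + N` with `B` = `obsMatrix` and `e = M ybar` with `det M = 1`. The
Fisher matrix is `1 + Bᵀ B` and the MMSE matrix is its inverse. The Kalman gain makes the
innovations orthogonal with variances `v t` = `innovVar t`, so `M (1 + B Bᵀ) Mᵀ` is diagonal with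
entries `v t`; with `det (1 + Bᵀ B) = det (1 + B Bᵀ)` this gives `∏ v t`. The log ratio of the joint
density to the product of the marginals is the sum of `½ log v t + e t² / (2 v t) - N t² / 2`, and
the two quadratic terms cancel in the mean (`mutualInfo_of_whitening`).

Power. The Kalman input `u t` is orthogonal to the past of `e`, while the input under any feedback
is `u t` plus an element of that past. By Pythagoras `u` has least power, and `u t` is the error of
predicting `r t` from the past of `ybar`. -/

theorem pi_withDensity_ofReal {ι : Type*} [Fintype ι] (g : ι → ℝ → ℝ)
    (hpos : ∀ i x, 0 ≤ g i x) (hint : ∀ i, Integrable (g i))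
    [∀ i, SigmaFinite ((volume : Measure ℝ).withDensity fun x => ENNReal.ofReal (g i x))] :
    Measure.pi (fun i => (volume : Measure ℝ).withDensity fun x => ENNReal.ofReal (g i x)) =
      (volume : Measure (ι → ℝ)).withDensity fun x => ENNReal.ofReal (∏ i, g i (x i)) := by
  refine Measure.pi_eq fun s hs => ?_
  rw [withDensity_apply _ (MeasurableSet.univ_pi hs), volume_pi, Measure.restrict_pi_pi,
    ← ofReal_integral_eq_lintegral_ofReal, integral_fintype_prod_eq_prod,
    ENNReal.ofReal_prod_of_nonneg (fun i _ => integral_nonneg (hpos i))]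
  · refine Finset.prod_congr rfl fun i _ => ?_
    rw [withDensity_apply _ (hs i), ofReal_integral_eq_lintegral_ofReal (hint i).restrict
      (ae_of_all _ (hpos i))]
  · exact Integrable.fintype_prod fun i => (hint i).restrict
  · exact ae_of_all _ fun x => Finset.prod_nonneg fun i _ => hpos i _

/-- Change of variables without a Jacobian: it transports Gaussian product densities through shears
and through matrices of determinant one. -/
theorem map_withDensity_comp {α : Type*} [MeasurableSpace α] {ν : Measure α} {φ : α → α}
    (hφ : MeasurePreserving φ ν ν) {f : α → ENNReal} (hf : Measurable f) :
    (ν.withDensity (f ∘ φ)).map φ = ν.withDensity f := by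
  ext s hs
  rw [Measure.map_apply hφ.measurable hs, withDensity_apply _ (hφ.measurable hs),
    withDensity_apply _ hs]
  exact hφ.setLIntegral_comp_preimage hs hf

/-- With positive densities over a common reference measure, `f / g` is the density of `π` relative
to `P`, so the log-likelihood ratio is a difference of logarithms. -/
theorem klDiv_withDensity {α : Type*} [MeasurableSpace α] {ν π P : Measure α} [SigmaFinite ν]
    [IsProbabilityMeasure π] [IsProbabilityMeasure P] {f g : α → ℝ}
    (hf : Measurable f) (hg : Measurable g) (hf0 : ∀ x, 0 < f x) (hg0 : ∀ x, 0 < g x)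
    (hπ : π = ν.withDensity fun x => ENNReal.ofReal (f x))
    (hP : P = ν.withDensity fun x => ENNReal.ofReal (g x))
    (hint : Integrable (fun x => Real.log (f x) - Real.log (g x)) π) :
    InformationTheory.klDiv π P ≠ ⊤ ∧
      (InformationTheory.klDiv π P).toReal = ∫ x, (Real.log (f x) - Real.log (g x)) ∂π := by
  have hm : Measurable fun x => ENNReal.ofReal (f x / g x) := by fun_prop
  have hrel : π = P.withDensity fun x => ENNReal.ofReal (f x / g x) := by
    rw [hπ, hP, ← withDensity_mul _ (by fun_prop) hm]
    congr 1
    funext x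
    rw [Pi.mul_apply, ← ENNReal.ofReal_mul (hg0 x).le, mul_div_cancel₀ _ (hg0 x).ne']
  have hac : π ≪ P := hrel ▸ withDensity_absolutelyContinuous _ _
  have hllr : llr π P =ᵐ[π] fun x => Real.log (f x) - Real.log (g x) := by
    have h := hac.ae_le (Measure.rnDeriv_withDensity P hm)
    rw [← hrel] at h
    filter_upwards [h] with x hx
    rw [llr, hx, ENNReal.toReal_ofReal (div_pos (hf0 x) (hg0 x)).le,
      Real.log_div (hf0 x).ne' (hg0 x).ne']
  refine ⟨InformationTheory.klDiv_ne_top hac ((integrable_congr hllr).2 hint), ?_⟩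
  -- Both measures have mass one, so the mass correction in `klDiv` vanishes.
  rw [InformationTheory.toReal_klDiv_of_measure_eq hac (by simp), integral_congr_ae hllr]

theorem measurePreserving_mulVec {ι : Type*} [Fintype ι] [DecidableEq ι] {M : Matrix ι ι ℝ}
    (hM : M.det = 1) :
    MeasurePreserving (fun y : ι → ℝ => M *ᵥ y) volume volume := by
  have h := Real.map_matrix_volume_pi_eq_smul_volume_pi (M := M) (by simp [hM])
  refine ⟨?_, ?_⟩
  · exact (LinearMap.continuous_of_finiteDimensional (Matrix.mulVecLin M)).measurable
  · have hfun : (fun y : ι → ℝ => M *ᵥ y) = ⇑(Matrix.toLin' M) := rfl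
    rw [hfun]
    simpa [hM] using h

theorem measurePreserving_shear {ι κ : Type*} [Fintype ι] [Fintype κ] (B : Matrix κ ι ℝ) :
    MeasurePreserving (fun z : (ι → ℝ) × (κ → ℝ) => (z.1, z.2 - B *ᵥ z.1)) volume volume := by
  have hB : Measurable fun w : ι → ℝ => B *ᵥ w :=
    (LinearMap.continuous_of_finiteDimensional (Matrix.mulVecLin B)).measurable
  refine (MeasurePreserving.id volume).skew_product (g := fun w y => y - B *ᵥ w) ?_
    (ae_of_all _ fun w => ?_)
  · exact measurable_snd.sub (hB.comp measurable_fst)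
  · exact (measurePreserving_sub_right volume (B *ᵥ w)).map_eq

end Density

/-! ### Invariance of mutual information, and Gaussian conditional means -/

section General

variable {Ω : Type*} [MeasurableSpace Ω] {μ : Measure Ω} [IsProbabilityMeasure μ]

/-- Data processing: both the joint law and the product of marginals are pushed forward by `Prod.map
id g`, and relative entropy does not increase under a map. -/
theorem mutualInfo_comp_le {E E' E'' : Type*} [MeasurableSpace E] [MeasurableSpace E']
    [MeasurableSpace E''] {X : Ω → E} {Y : Ω → E'} (hX : Measurable X) (hY : Measurable Y)
    {g : E' → E''} (hg : Measurable g) :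
    mutualInfo μ X (fun ω => g (Y ω)) ≤ mutualInfo μ X Y := by
  have h1 : (μ.map fun ω => (X ω, g (Y ω))) =
      (μ.map fun ω => (X ω, Y ω)).map (Prod.map id g) := by
    rw [Measure.map_map (by fun_prop) (by fun_prop)]
    rfl
  have : IsProbabilityMeasure (μ.map fun ω => (X ω, Y ω)) :=
    Measure.isProbabilityMeasure_map (by fun_prop)
  have : IsProbabilityMeasure (μ.map X) := Measure.isProbabilityMeasure_map hX.aemeasurable
  have : IsProbabilityMeasure (μ.map Y) := Measure.isProbabilityMeasure_map hY.aemeasurable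
  have h2 : (μ.map X).prod (μ.map fun ω => g (Y ω)) =
      ((μ.map X).prod (μ.map Y)).map (Prod.map id g) := by
    rw [← Measure.map_prod_map _ _ measurable_id hg, Measure.map_id, Measure.map_map hg hY]
    rfl
  rw [mutualInfo, mutualInfo, h1, h2]
  exact InformationTheory.klDiv_map_le _ _ (by fun_prop)

/-- Data processing is applied twice, once to `M` and once to `M⁻¹`. -/
theorem mutualInfo_mulVec {E ι : Type*} [MeasurableSpace E] [Fintype ι] [DecidableEq ι]
    {X : Ω → E} {Y : Ω → ι → ℝ} (hX : Measurable X) (hY : Measurable Y) {M : Matrix ι ι ℝ}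
    (hM : IsUnit M.det) :
    mutualInfo μ X (fun ω => M *ᵥ Y ω) = mutualInfo μ X Y := by
  have hmeas : ∀ A : Matrix ι ι ℝ, Measurable fun y : ι → ℝ => A *ᵥ y := fun A =>
    (LinearMap.continuous_of_finiteDimensional (Matrix.mulVecLin A)).measurable
  refine le_antisymm (mutualInfo_comp_le hX hY (hmeas M)) ?_
  have h := mutualInfo_comp_le (μ := μ) hX ((hmeas M).comp hY) (hmeas M⁻¹)
  simpa [Function.comp_def, Matrix.mulVec_mulVec, Matrix.nonsing_inv_mul _ hM] using h

/-- For jointly Gaussian variables, a linear estimator with an uncorrelated error is the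
conditional mean. -/
theorem condMean_ae_eq {k : ℕ} {X D : Ω → ℝ} {Y : Fin k → Ω → ℝ}
    (hY : ∀ j, Measurable (Y j)) (hD : Measurable D)
    (hG : HasGaussianLaw (fun ω => (fun _ : Fin 1 => D ω, fun j => Y j ω)) μ)
    (hD0 : ∫ ω, D ω ∂μ = 0) (hcov : ∀ j, ∫ ω, D ω * Y j ω ∂μ = 0)
    (hXD : ∃ a : Fin k → ℝ, ∀ ω, X ω - D ω = ∑ j, a j * Y j ω) :
    condMean μ X (fun ω j => Y j ω) =ᵐ[μ] fun ω => X ω - D ω := by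
  obtain ⟨a, ha⟩ := hXD
  have hYm : Measurable fun ω j => Y j ω := measurable_pi_lambda _ hY
  have hD2 : MemLp D 2 μ := (hG.fst.map (ContinuousLinearMap.proj (R := ℝ) (0 : Fin 1))).memLp_two
  have hY2 : ∀ j, MemLp (Y j) 2 μ := fun j =>
    (hG.snd.map (ContinuousLinearMap.proj (R := ℝ) j)).memLp_two
  -- The independence criterion is stated for two finite families, hence the one-element family over
  -- `Fin 1`.
  have hind : IndepFun (fun ω (_ : Fin 1) => D ω) (fun ω j => Y j ω) μ := by
    refine HasGaussianLaw.indepFun_of_covariance_eval (X := fun _ => D) (Y := Y) hG fun _ j => ?_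
    rw [covariance_eq_sub hD2 (hY2 j), hD0, zero_mul, sub_zero]
    exact hcov j
  have hind' : Indep (MeasurableSpace.comap D inferInstance)
      (MeasurableSpace.comap (fun ω j => Y j ω) inferInstance) μ := by
    have h : IndepFun D (fun ω j => Y j ω) μ :=
      hind.comp (measurable_pi_apply (0 : Fin 1)) measurable_id
    exact (IndepFun_iff_Indep _ _ _).1 h
  have hDc : μ[D | MeasurableSpace.comap (fun ω j => Y j ω) inferInstance] =ᵐ[μ] 0 := by
    have h := condExp_indep_eq hD.comap_le hYm.comap_le
      (comap_measurable D).stronglyMeasurable hind'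
    rw [hD0] at h
    exact h
  have hL : StronglyMeasurable[MeasurableSpace.comap (fun ω j => Y j ω) inferInstance] fun ω => ∑ j, a j * Y j ω := by
    have h0 : Measurable fun y : Fin k → ℝ => ∑ j, a j * y j := by fun_prop
    exact (h0.comp (comap_measurable fun ω j => Y j ω)).stronglyMeasurable
  have hLint : Integrable (fun ω => ∑ j, a j * Y j ω) μ :=
    integrable_finsetSum _ fun j _ => ((hY2 j).integrable one_le_two).const_mul _
  have hXeq : X = (fun ω => ∑ j, a j * Y j ω) + D := by
    funext ω
    have := ha ω
    simp only [Pi.add_apply]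
    linarith
  have hadd := condExp_add hLint (hD2.integrable one_le_two)
    (MeasurableSpace.comap (fun ω j => Y j ω) inferInstance)
  rw [condMean, hXeq]
  filter_upwards [hadd, hDc] with ω h1 h2
  rw [h1, Pi.add_apply, h2, condExp_of_stronglyMeasurable hYm.comap_le hL hLint]
  simp

end General

end FeedbackCoding

namespace FeedbackCoding

/-! ### The Gaussian space of the message and the noise -/

section NoiseSpan

variable {Ω : Type*}

/-- The linear span of the message coordinates and of the noise at the times before `t`. -/
def noiseSpan {d : ℕ} (W : Ω → Fin d → ℝ) (N : ℕ → Ω → ℝ) (t : ℕ) : Submodule ℝ (Ω → ℝ) :=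
  Submodule.span ℝ (Set.range (fun i ω => W ω i) ∪ N '' Set.Iio t)

variable {d : ℕ} {W : Ω → Fin d → ℝ} {N : ℕ → Ω → ℝ}

theorem message_mem_noiseSpan (i : Fin d) (t : ℕ) : (fun ω => W ω i) ∈ noiseSpan W N t :=
  Submodule.subset_span (Or.inl ⟨i, rfl⟩)

theorem noise_mem_noiseSpan {s t : ℕ} (h : s < t) : N s ∈ noiseSpan W N t :=
  Submodule.subset_span (Or.inr ⟨s, h, rfl⟩)

theorem noiseSpan_mono {s t : ℕ} (h : s ≤ t) : noiseSpan W N s ≤ noiseSpan W N t :=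
  Submodule.span_mono (Set.union_subset_union_right _ (Set.image_mono (Set.Iio_subset_Iio h)))

/-- Membership in the span is a purely algebraic property. This factorization through one Gaussian
vector turns it into measurability, joint Gaussianity and integrability. -/
theorem exists_clm_of_mem_noiseSpan {t : ℕ} {X : Ω → ℝ} (hX : X ∈ noiseSpan W N t) :
    ∃ L : (Fin d → ℝ) × (Fin t → ℝ) →L[ℝ] ℝ, ∀ ω, X ω = L (W ω, fun τ => N τ ω) := by
  induction hX using Submodule.span_induction with
  | mem X h =>
    rcases h with ⟨i, rfl⟩ | ⟨s, hs, rfl⟩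
    · exact ⟨(ContinuousLinearMap.proj i).comp (ContinuousLinearMap.fst ℝ _ _), fun ω => rfl⟩
    · exact ⟨(ContinuousLinearMap.proj (⟨s, hs⟩ : Fin t)).comp (ContinuousLinearMap.snd ℝ _ _),
        fun ω => rfl⟩
  | zero => exact ⟨0, fun ω => rfl⟩
  | add X Y _ _ hX hY =>
    obtain ⟨L, hL⟩ := hX
    obtain ⟨L', hL'⟩ := hY
    exact ⟨L + L', fun ω => by simp [hL, hL']⟩
  | smul a X _ hX =>
    obtain ⟨L, hL⟩ := hX
    exact ⟨a • L, fun ω => by simp [hL]⟩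

theorem dotProduct_mem {ι : Type*} [Fintype ι] {U : Submodule ℝ (Ω → ℝ)} {X : Ω → ι → ℝ}
    (hX : ∀ i, (fun ω => X ω i) ∈ U) (a : ι → ℝ) : (fun ω => a ⬝ᵥ X ω) ∈ U := by
  have h1 : (fun ω => a ⬝ᵥ X ω) = ∑ i, a i • fun ω => X ω i := by
    funext ω
    simp [dotProduct]
  rw [h1]
  exact Submodule.sum_mem _ fun i _ => Submodule.smul_mem _ _ (hX i)

end NoiseSpan

section NoiseSpace

variable {Ω : Type*} [MeasurableSpace Ω]

/-- A standard Gaussian message `W`, independent of the standard white Gaussian noise `N`. -/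
structure IsGaussianModel {d : ℕ} (μ : Measure Ω) (W : Ω → Fin d → ℝ) (N : ℕ → Ω → ℝ) : Prop where
  measurable_message : Measurable W
  measurable_noise : ∀ t, Measurable (N t)
  law_message : μ.map W = Measure.pi fun _ => gaussianReal 0 1
  law_noise : ∀ t, μ.map (N t) = gaussianReal 0 1
  iIndepFun_noise : iIndepFun N μ
  indepFun : IndepFun W (fun ω t => N t ω) μ

variable {d : ℕ} {μ : Measure Ω} {W : Ω → Fin d → ℝ} {N : ℕ → Ω → ℝ}

namespace IsGaussianModel

variable (h : IsGaussianModel μ W N)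
include h

theorem measurable_samples (k : ℕ) : Measurable fun ω (τ : Fin k) => N τ ω :=
  measurable_pi_lambda _ fun τ => h.measurable_noise τ

theorem measurable_coord (i : Fin d) : Measurable fun ω => W ω i :=
  (measurable_pi_apply i).comp h.measurable_message

theorem law_coord (i : Fin d) : μ.map (fun ω => W ω i) = gaussianReal 0 1 := by
  have h1 : μ.map (fun ω => W ω i) = (μ.map W).map (Function.eval i) := by
    rw [Measure.map_map (measurable_pi_apply i) h.measurable_message]
    rfl
  rw [h1, h.law_message, Measure.pi_map_eval]
  simp

theorem isProbabilityMeasure : IsProbabilityMeasure μ := h.iIndepFun_noise.isProbabilityMeasure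

theorem iIndepFun_coord : iIndepFun (fun i ω => W ω i) μ := by
  have := h.isProbabilityMeasure
  rw [iIndepFun_iff_map_fun_eq_pi_map fun i => (h.measurable_coord i).aemeasurable]
  simp_rw [h.law_coord]
  exact h.law_message

theorem indepFun_samples (k : ℕ) : IndepFun W (fun ω (τ : Fin k) => N τ ω) μ :=
  h.indepFun.comp (φ := id) (ψ := fun (ν : ℕ → ℝ) (τ : Fin k) => ν τ) measurable_id
    (measurable_pi_lambda _ fun τ => measurable_pi_apply (τ : ℕ))

theorem law_samples (k : ℕ) :
    μ.map (fun ω (τ : Fin k) => N τ ω) = Measure.pi fun _ => gaussianReal 0 1 := by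
  have := h.isProbabilityMeasure
  have h1 := iIndepFun.map_fun_eq_pi_map (f := fun (τ : Fin k) ω => N τ ω)
    (fun i => (h.measurable_noise i).aemeasurable)
    (h.iIndepFun_noise.precomp (Fin.val_injective (n := k)))
  simp only [h.law_noise] at h1
  exact h1

theorem law_joint (k : ℕ) : μ.map (fun ω => (W ω, fun τ : Fin k => N τ ω)) =
    (Measure.pi fun _ => gaussianReal 0 1).prod (Measure.pi fun _ => gaussianReal 0 1) := by
  have := h.isProbabilityMeasure
  rw [(indepFun_iff_map_prod_eq_prod_map_map h.measurable_message.aemeasurable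
    (h.measurable_samples k).aemeasurable).1 (h.indepFun_samples k), h.law_message,
    h.law_samples]

theorem hasGaussianLaw_joint (k : ℕ) :
    HasGaussianLaw (fun ω => (W ω, fun τ : Fin k => N τ ω)) μ := by
  have h1 : HasGaussianLaw W μ := iIndepFun.hasGaussianLaw (X := fun i ω => W ω i)
    (fun i => ⟨by rw [h.law_coord]; infer_instance⟩) h.iIndepFun_coord
  have h2 : HasGaussianLaw (fun ω (τ : Fin k) => N τ ω) μ :=
    iIndepFun.hasGaussianLaw (X := fun (τ : Fin k) ω => N τ ω)
      (fun i => ⟨by rw [h.law_noise]; infer_instance⟩)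
      (h.iIndepFun_noise.precomp Fin.val_injective)
  exact (h.indepFun_samples k).hasGaussianLaw h1 h2

theorem hasGaussianLaw_pi {ι : Type*} [Fintype ι] {t : ℕ} {X : ι → Ω → ℝ}
    (hX : ∀ i, X i ∈ noiseSpan W N t) : HasGaussianLaw (fun ω i => X i ω) μ := by
  choose L hL using fun i => exists_clm_of_mem_noiseSpan (hX i)
  have h1 : (fun ω i => X i ω) = fun ω => ContinuousLinearMap.pi L (W ω, fun τ : Fin t => N τ ω) :=
    funext fun ω => funext fun i => hL i ω
  rw [h1]
  exact (h.hasGaussianLaw_joint t).map_fun (ContinuousLinearMap.pi L)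

theorem hasGaussianLaw_prod {ι κ : Type*} [Fintype ι] [Fintype κ] {t : ℕ} {X : ι → Ω → ℝ}
    {Y : κ → Ω → ℝ} (hX : ∀ i, X i ∈ noiseSpan W N t) (hY : ∀ i, Y i ∈ noiseSpan W N t) :
    HasGaussianLaw (fun ω => (fun i => X i ω, fun i => Y i ω)) μ := by
  choose L hL using fun i => exists_clm_of_mem_noiseSpan (hX i)
  choose L' hL' using fun i => exists_clm_of_mem_noiseSpan (hY i)
  have h1 : (fun ω => (fun i => X i ω, fun i => Y i ω)) = fun ω =>
      (ContinuousLinearMap.pi L).prod (ContinuousLinearMap.pi L')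
        (W ω, fun τ : Fin t => N τ ω) :=
    funext fun ω => Prod.ext (funext fun i => hL i ω) (funext fun i => hL' i ω)
  rw [h1]
  exact (h.hasGaussianLaw_joint t).map_fun _

theorem hasGaussianLaw {t : ℕ} {X : Ω → ℝ} (hX : X ∈ noiseSpan W N t) : HasGaussianLaw X μ := by
  obtain ⟨L, hL⟩ := exists_clm_of_mem_noiseSpan hX
  rw [funext hL]
  exact (h.hasGaussianLaw_joint t).map_fun L

theorem measurable {t : ℕ} {X : Ω → ℝ} (hX : X ∈ noiseSpan W N t) : Measurable X := by
  obtain ⟨L, hL⟩ := exists_clm_of_mem_noiseSpan hX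
  rw [funext hL]
  exact L.measurable.comp (h.measurable_message.prodMk (h.measurable_samples t))

theorem memLp_two {t : ℕ} {X : Ω → ℝ} (hX : X ∈ noiseSpan W N t) : MemLp X 2 μ :=
  (h.hasGaussianLaw hX).memLp_two

theorem integrable {t : ℕ} {X : Ω → ℝ} (hX : X ∈ noiseSpan W N t) : Integrable X μ :=
  (h.hasGaussianLaw hX).integrable

theorem integrable_mul {s t : ℕ} {X Y : Ω → ℝ} (hX : X ∈ noiseSpan W N s)
    (hY : Y ∈ noiseSpan W N t) : Integrable (fun ω => X ω * Y ω) μ :=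
  (h.memLp_two hX).integrable_mul (h.memLp_two hY)

theorem integral_message (i : Fin d) : ∫ ω, W ω i ∂μ = 0 := by
  have h1 := integral_map (μ := μ) (f := fun x : ℝ => x) (h.measurable_coord i).aemeasurable
    (by fun_prop : AEStronglyMeasurable (fun x : ℝ => x) _)
  rw [← h1, h.law_coord, integral_id_gaussianReal]

theorem integral_noise (t : ℕ) : ∫ ω, N t ω ∂μ = 0 := by
  have h1 := integral_map (μ := μ) (f := fun x : ℝ => x) (h.measurable_noise t).aemeasurable
    (by fun_prop : AEStronglyMeasurable (fun x : ℝ => x) _)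
  rw [← h1, h.law_noise, integral_id_gaussianReal]

theorem integral_eq_zero {t : ℕ} {X : Ω → ℝ} (hX : X ∈ noiseSpan W N t) : ∫ ω, X ω ∂μ = 0 := by
  induction hX using Submodule.span_induction with
  | mem X hX =>
    rcases hX with ⟨i, rfl⟩ | ⟨s, -, rfl⟩
    · exact h.integral_message i
    · exact h.integral_noise s
  | zero => simp
  | add X Y hX hY hX0 hY0 =>
    simp only [Pi.add_apply]
    rw [integral_add (h.integrable hX) (h.integrable hY), hX0, hY0, add_zero]
  | smul a X _ hX0 =>
    simp only [Pi.smul_apply, smul_eq_mul]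
    rw [integral_const_mul, hX0, mul_zero]

omit h in
theorem integral_sq_of_law {X : Ω → ℝ} (hm : Measurable X) (hl : μ.map X = gaussianReal 0 1) :
    ∫ ω, X ω * X ω ∂μ = 1 := by
  have h1 := integral_map (μ := μ) (f := fun x : ℝ => x * x) hm.aemeasurable
    (by fun_prop : AEStronglyMeasurable (fun x : ℝ => x * x) _)
  have h2 := variance_id_gaussianReal (μ := 0) (v := 1)
  rw [variance_eq_integral (by fun_prop)] at h2
  simp only [id, integral_id_gaussianReal, sub_zero] at h2
  rw [← h1, hl]
  simpa [sq] using h2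

theorem integral_message_mul (i j : Fin d) :
    ∫ ω, W ω i * W ω j ∂μ = (1 : Matrix (Fin d) (Fin d) ℝ) i j := by
  by_cases hij : i = j
  · subst hij
    rw [integral_sq_of_law (h.measurable_coord i) (h.law_coord i), Matrix.one_apply_eq]
  · rw [Matrix.one_apply_ne hij,
      (h.iIndepFun_coord.indepFun hij).integral_fun_mul_eq_mul_integral
        (h.measurable_coord i).aestronglyMeasurable (h.measurable_coord j).aestronglyMeasurable,
      h.integral_message, zero_mul]

theorem integral_noise_sq (t : ℕ) : ∫ ω, N t ω * N t ω ∂μ = 1 :=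
  integral_sq_of_law (h.measurable_noise t) (h.law_noise t)

theorem integral_mul_noise {t s : ℕ} (hts : t ≤ s) {X : Ω → ℝ} (hX : X ∈ noiseSpan W N t) :
    ∫ ω, X ω * N s ω ∂μ = 0 := by
  have hs : N s ∈ noiseSpan W N (s + 1) := noise_mem_noiseSpan (Nat.lt_succ_self s)
  induction hX using Submodule.span_induction with
  | mem X hX =>
    rcases hX with ⟨i, rfl⟩ | ⟨r, hr, rfl⟩
    · have hind : IndepFun (fun ω => W ω i) (N s) μ :=
        h.indepFun.comp (measurable_pi_apply i) (measurable_pi_apply s)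
      rw [hind.integral_fun_mul_eq_mul_integral (h.measurable_coord i).aestronglyMeasurable
        (h.measurable_noise s).aestronglyMeasurable, h.integral_noise, mul_zero]
    · have hne : r ≠ s := (lt_of_lt_of_le hr hts).ne
      rw [(h.iIndepFun_noise.indepFun hne).integral_fun_mul_eq_mul_integral
        (h.measurable_noise r).aestronglyMeasurable (h.measurable_noise s).aestronglyMeasurable,
        h.integral_noise, zero_mul]
  | zero => simp
  | add X Y hX hY hX0 hY0 =>
    simp only [Pi.add_apply, add_mul]
    rw [integral_add (h.integrable_mul hX hs) (h.integrable_mul hY hs), hX0, hY0, add_zero]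
  | smul a X _ hX0 =>
    simp only [Pi.smul_apply, smul_eq_mul, mul_assoc]
    rw [integral_const_mul, hX0, mul_zero]

theorem integral_noise_mul {k : ℕ} (i j : Fin k) :
    ∫ ω, N i ω * N j ω ∂μ = (1 : Matrix (Fin k) (Fin k) ℝ) i j := by
  rcases lt_trichotomy i j with hij | rfl | hij
  · rw [Matrix.one_apply_ne hij.ne]
    exact h.integral_mul_noise hij (noise_mem_noiseSpan (Nat.lt_succ_self _))
  · rw [h.integral_noise_sq, Matrix.one_apply_eq]
  · rw [Matrix.one_apply_ne hij.ne']
    simp_rw [mul_comm (N i _)]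
    exact h.integral_mul_noise hij (noise_mem_noiseSpan (Nat.lt_succ_self _))

end IsGaussianModel

/-- Second moments of linear combinations. -/
theorem integral_sum_mul_sum {ι κ : Type*} [Fintype ι] [Fintype κ] {X : ι → Ω → ℝ}
    {Y : κ → Ω → ℝ} (hint : ∀ i j, Integrable (fun ω => X i ω * Y j ω) μ)
    (a : ι → ℝ) (b : κ → ℝ) :
    ∫ ω, (∑ i, a i * X i ω) * (∑ j, b j * Y j ω) ∂μ =
      ∑ i, ∑ j, a i * b j * ∫ ω, X i ω * Y j ω ∂μ := by
  have h1 : ∀ ω, (∑ i, a i * X i ω) * (∑ j, b j * Y j ω) =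
      ∑ i, ∑ j, a i * b j * (X i ω * Y j ω) := fun ω => by
    rw [Finset.sum_mul_sum]
    exact Finset.sum_congr rfl fun i _ => Finset.sum_congr rfl fun j _ => by ring
  simp_rw [h1]
  rw [integral_finsetSum _ fun i _ => integrable_finsetSum _ fun j _ => (hint i j).const_mul _]
  refine Finset.sum_congr rfl fun i _ => ?_
  rw [integral_finsetSum _ fun j _ => (hint i j).const_mul _]
  exact Finset.sum_congr rfl fun j _ => integral_const_mul _ _

theorem IsGaussianModel.integral_linear_mul (h : IsGaussianModel μ W N) {k : ℕ}
    (a a' : Fin d → ℝ) (b b' : Fin k → ℝ) :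
    ∫ ω, (a ⬝ᵥ W ω + b ⬝ᵥ fun τ : Fin k => N τ ω) *
      (a' ⬝ᵥ W ω + b' ⬝ᵥ fun τ : Fin k => N τ ω) ∂μ = a ⬝ᵥ a' + b ⬝ᵥ b' := by
  have hW : ∀ i, (fun ω => W ω i) ∈ noiseSpan W N k := fun i => message_mem_noiseSpan i k
  have hN : ∀ τ : Fin k, N τ ∈ noiseSpan W N k := fun τ => noise_mem_noiseSpan τ.2
  have hWN : ∀ (i : Fin d) (τ : Fin k), ∫ ω, W ω i * N τ ω ∂μ = 0 := fun i τ =>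
    h.integral_mul_noise (Nat.zero_le _) (message_mem_noiseSpan i 0)
  have key := integral_sum_mul_sum (μ := μ)
    (X := Sum.elim (fun i ω => W ω i) (fun (τ : Fin k) ω => N τ ω))
    (Y := Sum.elim (fun i ω => W ω i) (fun (τ : Fin k) ω => N τ ω))
    (by
      rintro (i | i) (j | j)
      · exact h.integrable_mul (hW i) (hW j)
      · exact h.integrable_mul (hW i) (hN j)
      · exact h.integrable_mul (hN i) (hW j)
      · exact h.integrable_mul (hN i) (hN j)) (Sum.elim a b) (Sum.elim a' b')
  simp only [Fintype.sum_sum_type, Sum.elim_inl, Sum.elim_inr] at key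
  have hNW : ∀ (i : Fin d) (τ : Fin k), ∫ ω, N τ ω * W ω i ∂μ = 0 := fun i τ => by
    simp_rw [mul_comm (N _ _)]
    exact hWN i τ
  simp only [hWN, hNW, h.integral_message_mul, h.integral_noise_mul, Matrix.one_apply] at key
  simpa [dotProduct] using key

end NoiseSpace

end FeedbackCoding

namespace FeedbackCoding

/-! ### The span of the past of a process -/

section Past

variable {Ω : Type*}

/-- The linear span of the values of a process before time `t`. -/
def past (Y : ℕ → Ω → ℝ) (t : ℕ) : Submodule ℝ (Ω → ℝ) := Submodule.span ℝ (Y '' Set.Iio t)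

theorem mem_past {Y : ℕ → Ω → ℝ} {s t : ℕ} (h : s < t) : Y s ∈ past Y t :=
  Submodule.subset_span ⟨s, h, rfl⟩

theorem past_mono (Y : ℕ → Ω → ℝ) {s t : ℕ} (h : s ≤ t) : past Y s ≤ past Y t :=
  Submodule.span_mono (Set.image_mono (Set.Iio_subset_Iio h))

theorem past_le_iff {Y : ℕ → Ω → ℝ} {t : ℕ} {U : Submodule ℝ (Ω → ℝ)} :
    past Y t ≤ U ↔ ∀ s < t, Y s ∈ U := by
  rw [past, Submodule.span_le, Set.image_subset_iff]
  rfl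

/-- A unit triangular change of generators can be inverted: strong induction recovers each `Y s`
from `Z s` and earlier values. -/
theorem past_eq_past {Y Z : ℕ → Ω → ℝ} {t : ℕ} (h : ∀ s < t, Z s - Y s ∈ past Y s) :
    past Z t = past Y t := by
  refine le_antisymm (past_le_iff.2 fun s hs => ?_) (past_le_iff.2 fun s hs => ?_)
  · have h1 := Submodule.add_mem _ (past_mono Y hs.le (h s hs)) (mem_past (Y := Y) hs)
    simpa using h1
  · induction s using Nat.strong_induction_on with
    | _ s ih =>
      have h1 : past Y s ≤ past Z t := past_le_iff.2 fun r hr => ih r hr (hr.trans hs)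
      have h2 := Submodule.sub_mem _ (mem_past (Y := Z) hs) (h1 (h s hs))
      simpa using h2

theorem exists_coeff_of_mem_past {Y : ℕ → Ω → ℝ} {t : ℕ} {X : Ω → ℝ} (hX : X ∈ past Y t) :
    ∃ a : Fin t → ℝ, ∀ ω, X ω = ∑ j, a j * Y j ω := by
  have h1 : Y '' Set.Iio t = Set.range fun j : Fin t => Y j := by
    ext Z
    constructor
    · rintro ⟨s, hs, rfl⟩
      exact ⟨⟨s, hs⟩, rfl⟩
    · rintro ⟨j, rfl⟩
      exact ⟨j, j.2, rfl⟩
  rw [past, h1, Submodule.mem_span_range_iff_exists_fun] at hX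
  obtain ⟨a, rfl⟩ := hX
  exact ⟨a, fun ω => by simp⟩

theorem exists_isStrictlyLower {X Y : ℕ → Ω → ℝ} {k : ℕ} (h : ∀ t < k, X t ∈ past Y t) :
    ∃ K : Matrix (Fin k) (Fin k) ℝ, IsStrictlyLower K ∧
      ∀ ω (t : Fin k), X t ω = (K *ᵥ firstSamples Y k ω) t := by
  choose a ha using fun t : Fin k => exists_coeff_of_mem_past (h t t.2)
  refine ⟨Matrix.of fun i j => if hij : j < i then a i ⟨j, hij⟩ else 0, fun i j hij => ?_,
    fun ω t => ?_⟩
  · simp [hij]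
  · rw [ha]
    simp only [mulVec, dotProduct, firstSamples, of_apply]
    -- The summand is extended to a function on `ℕ`, so that the sum over `Fin k` can be cut down to
    -- the indices below `t`.
    have h1 : ∀ j : Fin k, (if hij : j < t then a t ⟨j, hij⟩ else 0) * Y j ω =
        (fun j : ℕ => if hij : j < t then a t ⟨j, hij⟩ * Y j ω else 0) j := fun j => by
      by_cases hij : j < t
      · have : (j : ℕ) < t := hij
        simp [hij]
      · have : ¬ (j : ℕ) < t := hij
        simp [hij]
    simp_rw [h1]
    rw [Fin.sum_univ_eq_sum_range
      (fun j : ℕ => if hij : j < t then a t ⟨j, hij⟩ * Y j ω else 0) k,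
      ← Finset.sum_subset (Finset.range_mono t.2.le), Finset.sum_range]
    · exact Finset.sum_congr rfl fun j _ => by simp
    · intro j _ hj
      simp at hj
      simp [hj.not_gt]

theorem mulVec_mem_past {Y : ℕ → Ω → ℝ} {k : ℕ} {K : Matrix (Fin k) (Fin k) ℝ}
    (hK : IsStrictlyLower K) (t : Fin k) :
    (fun ω => (K *ᵥ firstSamples Y k ω) t) ∈ past Y t := by
  have h1 : (fun ω => (K *ᵥ firstSamples Y k ω) t) = ∑ j, K t j • Y j := by
    funext ω
    simp [mulVec, dotProduct, firstSamples]
  rw [h1]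
  refine Submodule.sum_mem _ fun j _ => ?_
  by_cases hj : j < t
  · exact Submodule.smul_mem _ _ (mem_past hj)
  · rw [hK t j (not_lt.1 hj), zero_smul]
    exact Submodule.zero_mem _

theorem IsStrictlyLower.neg {k : ℕ} {K : Matrix (Fin k) (Fin k) ℝ} (hK : IsStrictlyLower K) :
    IsStrictlyLower (-K) := fun i j hij => by simp [hK i j hij]

theorem IsStrictlyLower.det_one_add {k : ℕ} {K : Matrix (Fin k) (Fin k) ℝ}
    (hK : IsStrictlyLower K) : (1 + K).det = 1 := by
  rw [Matrix.det_of_isLowerTriangular]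
  · exact Finset.prod_eq_one fun i _ => by simp [hK i i le_rfl]
  · intro i j hij
    have hij' : i < j := hij
    simp [hK i j hij'.le, hij'.ne]

theorem IsStrictlyLower.det_one_sub {k : ℕ} {K : Matrix (Fin k) (Fin k) ℝ}
    (hK : IsStrictlyLower K) : (1 - K).det = 1 := by
  rw [sub_eq_add_neg]
  exact hK.neg.det_one_add

/-- The differences give a strictly lower triangular `K`, and `1 + K` has determinant one. Such
matrices preserve Lebesgue measure and mutual information. -/
theorem exists_unitLower {Y Z : ℕ → Ω → ℝ} {k : ℕ} (h : ∀ t < k, Z t - Y t ∈ past Y t) :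
    ∃ M : Matrix (Fin k) (Fin k) ℝ, M.det = 1 ∧
      ∀ ω, firstSamples Z k ω = M *ᵥ firstSamples Y k ω := by
  obtain ⟨K, hK, h1⟩ := exists_isStrictlyLower h
  refine ⟨1 + K, hK.det_one_add, fun ω => funext fun t => ?_⟩
  rw [Matrix.add_mulVec, Matrix.one_mulVec, Pi.add_apply, ← h1]
  simp [firstSamples]

end Past

/-! ### The signals -/

namespace Params

variable {n m : ℕ} (S : Params n m)

/-! ### Pathwise identities for a fixed message and noise path -/

section Deterministic

variable (w : Fin (n + 1) → ℝ) (ν : ℕ → ℝ)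

theorem kalmanError_zero : S.kalmanError w ν 0 = Sum.elim w 0 := by
  simp [kalmanError, loop, LoopState.error]

theorem kalmanInput_eq (t : ℕ) : S.kalmanInput w ν t = S.bigD ⬝ᵥ S.kalmanError w ν t := by
  simp [kalmanInput, LoopState.input, bigD, kalmanError, LoopState.error, dotProduct_sub]

theorem kalmanInnov_eq (t : ℕ) :
    S.kalmanInnov w ν t = S.bigC ⬝ᵥ S.kalmanError w ν t + ν t := by
  simp only [kalmanInnov, LoopState.innov, LoopState.output, LoopState.input, bigC, kalmanError,
    LoopState.error, sumElim_dotProduct_sumElim, dotProduct_sub]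
  ring

theorem kalmanError_succ (t : ℕ) : S.kalmanError w ν (t + 1) =
    S.bigA *ᵥ S.kalmanError w ν t - S.kalmanInnov w ν t • S.gain t := by
  simp only [kalmanError, loop, LoopState.error, LoopState.step, bigA, kalmanInnov,
    fromBlocks_mulVec, Sum.elim_comp_inl, Sum.elim_comp_inr]
  ext (i | i)
  · simp [mulVec_sub]
    ring
  · simp [mulVec_sub, vecMulVec_mulVec, LoopState.input]
    ring

theorem loop_x (t : ℕ) : (S.loop w ν t).x = (S.A ^ t) *ᵥ w := by
  induction t with
  | zero => simp [loop]
  | succ t ih => simp [loop, LoopState.step, ih, pow_succ']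

theorem kalmanInput_eq_source_sub (t : ℕ) :
    S.kalmanInput w ν t = S.source w t - S.C ⬝ᵥ (S.loop w ν t).xhat := by
  simp [kalmanInput, LoopState.input, loop_x, source]

theorem kalmanInnov_eq_output_sub (t : ℕ) :
    S.kalmanInnov w ν t = S.kalmanOutput w ν t - S.H ⬝ᵥ (S.loop w ν t).shat := rfl

theorem state_eq_sum {σ : ℕ → Fin m → ℝ} {v : ℕ → ℝ} (h0 : σ 0 = 0)
    (hs : ∀ t, σ (t + 1) = S.F *ᵥ σ t + v t • S.G) (t : ℕ) :
    σ t = ∑ j ∈ Finset.range t, v j • ((S.F ^ (t - j - 1)) *ᵥ S.G) := by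
  induction t with
  | zero => simp [h0]
  | succ t ih =>
    rw [hs, Finset.sum_range_succ, ih, mulVec_sum]
    congr 1
    · refine Finset.sum_congr rfl fun j hj => ?_
      have hj' : t + 1 - j - 1 = (t - j - 1) + 1 := by
        have := Finset.mem_range.1 hj
        omega
      rw [mulVec_smul, hj', mulVec_mulVec, ← pow_succ']
    · simp

/-- Solving the state recursion from the zero state gives the convolution with the impulse response.
The diagonal entry is the direct feedthrough; the exponent `t - j - 1` is only used for `j < t`. -/
theorem output_eq_chanMatrix {σ : ℕ → Fin m → ℝ} {v : ℕ → ℝ} (h0 : σ 0 = 0)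
    (hs : ∀ t, σ (t + 1) = S.F *ᵥ σ t + v t • S.G) (T : ℕ) (t : Fin (T + 1)) :
    S.H ⬝ᵥ σ t + v t = (S.chanMatrix T *ᵥ fun j : Fin (T + 1) => v j) t := by
  have h1 : ∀ j : Fin (T + 1), S.chanMatrix T t j * v j =
      (fun j : ℕ => if (t : ℕ) = j then v j else
        if j < t then v j * (S.H ⬝ᵥ ((S.F ^ ((t : ℕ) - j - 1)) *ᵥ S.G)) else 0) j := fun j => by
    simp only [chanMatrix, of_apply, Fin.ext_iff, Fin.lt_def]
    split_ifs <;> ring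
  simp only [mulVec]
  simp only [dotProduct] at h1 ⊢
  simp_rw [h1]
  rw [Fin.sum_univ_eq_sum_range (fun j : ℕ => if (t : ℕ) = j then v j else
        if j < t then v j * (∑ i, S.H i * ((S.F ^ ((t : ℕ) - j - 1)) *ᵥ S.G) i) else 0) (T + 1),
    ← Finset.sum_subset (Finset.range_mono t.2 : Finset.range (t + 1) ⊆ _), Finset.sum_range_succ]
  · rw [if_pos rfl]
    congr 1
    rw [S.state_eq_sum h0 hs t]
    change S.H ⬝ᵥ _ = _
    rw [dotProduct_sum]
    refine Finset.sum_congr rfl fun j hj => ?_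
    have hj' := Finset.mem_range.1 hj
    rw [if_neg hj'.ne', if_pos hj', dotProduct_smul]
    rfl
  · intro j _ hj
    have hj' : (t : ℕ) < j := by simpa using hj
    rw [if_neg hj'.ne, if_neg hj'.not_gt]

theorem kalmanOutput_eq (T : ℕ) (t : Fin (T + 1)) : S.kalmanOutput w ν t =
    (S.chanMatrix T *ᵥ fun j : Fin (T + 1) => S.kalmanInput w ν j) t + ν t := by
  rw [← S.output_eq_chanMatrix (σ := fun t => (S.loop w ν t).s) (v := S.kalmanInput w ν) rfl
    (fun t => rfl)]
  rfl

theorem openOutput_eq (T : ℕ) (t : Fin (T + 1)) : S.openOutput w ν t =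
    (S.chanMatrix T *ᵥ fun j : Fin (T + 1) => S.source w j) t + ν t := by
  rw [← S.output_eq_chanMatrix (σ := S.openState w) (v := S.source w) rfl (fun t => rfl)]
  rfl

theorem chanMatrix_eq_zero {T : ℕ} {i j : Fin (T + 1)} (h : i < j) : S.chanMatrix T i j = 0 := by
  simp [chanMatrix, h.ne, h.not_gt]

theorem isStrictlyLower_chanMatrix_mul {T : ℕ} {K : Matrix (Fin (T + 1)) (Fin (T + 1)) ℝ}
    (hK : IsStrictlyLower K) : IsStrictlyLower (S.chanMatrix T * K) := fun i j hij => by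
  rw [Matrix.mul_apply]
  refine Finset.sum_eq_zero fun l _ => ?_
  rcases lt_or_ge i l with h | h
  · rw [S.chanMatrix_eq_zero h, zero_mul]
  · rw [hK l j (h.trans hij), mul_zero]

theorem fbOutput_eq (T : ℕ) (K : Matrix (Fin (T + 1)) (Fin (T + 1)) ℝ) :
    S.fbOutput T K w ν =
      (1 - S.chanMatrix T * K)⁻¹ *ᵥ fun t : Fin (T + 1) => S.openOutput w ν t := by
  rw [fbOutput]
  congr 1
  funext t
  rw [S.openOutput_eq]
  rfl

theorem fbOutput_sub {T : ℕ} {K : Matrix (Fin (T + 1)) (Fin (T + 1)) ℝ} (hK : IsStrictlyLower K)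
    (t : Fin (T + 1)) : S.fbOutput T K w ν t - S.openOutput w ν t =
      ((S.chanMatrix T * K) *ᵥ S.fbOutput T K w ν) t := by
  have hdet := (S.isStrictlyLower_chanMatrix_mul hK).det_one_sub
  have h1 : (1 - S.chanMatrix T * K) *ᵥ S.fbOutput T K w ν =
      fun t : Fin (T + 1) => S.openOutput w ν t := by
    rw [fbOutput_eq, mulVec_mulVec, Matrix.mul_nonsing_inv _ (by simp [hdet]), one_mulVec]
  have h2 := congrFun h1 t
  rw [sub_mulVec, one_mulVec, Pi.sub_apply] at h2
  linarith

/-- The feedback equation has a unique solution, because `1 - Z K` has determinant one. This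
identifies the Kalman loop with one particular linear feedback. -/
theorem eq_fbOutput {T : ℕ} {K : Matrix (Fin (T + 1)) (Fin (T + 1)) ℝ} (hK : IsStrictlyLower K)
    {y : Fin (T + 1) → ℝ}
    (hy : ∀ t : Fin (T + 1), y t - S.openOutput w ν t = ((S.chanMatrix T * K) *ᵥ y) t) :
    y = S.fbOutput T K w ν := by
  have hdet := (S.isStrictlyLower_chanMatrix_mul hK).det_one_sub
  have h1 : (1 - S.chanMatrix T * K) *ᵥ y = fun t : Fin (T + 1) => S.openOutput w ν t := by
    funext t
    rw [sub_mulVec, one_mulVec, Pi.sub_apply]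
    linarith [hy t]
  rw [fbOutput_eq, ← h1, mulVec_mulVec, Matrix.nonsing_inv_mul _ (by simp [hdet]), one_mulVec]

/-- The matrix of the linear map from the message to the noiseless output of the estimation
system. -/
def obsMatrix (T : ℕ) : Matrix (Fin (T + 1)) (Fin (n + 1)) ℝ :=
  S.chanMatrix T * Matrix.of fun t : Fin (T + 1) => S.C ᵥ* S.A ^ (t : ℕ)

theorem source_eq (t : ℕ) : S.source w t = (S.C ᵥ* S.A ^ t) ⬝ᵥ w :=
  dotProduct_mulVec _ _ _

theorem openOutput_eq_obsMatrix (T : ℕ) (t : Fin (T + 1)) :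
    S.openOutput w ν t = (S.obsMatrix T *ᵥ w) t + ν t := by
  rw [S.openOutput_eq, obsMatrix, ← mulVec_mulVec]
  congr 3
  funext j
  exact S.source_eq w j

end Deterministic

/-! ### Causal linear relations between source, outputs, innovations and inputs -/

section Processes

variable {Ω : Type*} (W : Ω → Fin (n + 1) → ℝ) (N : ℕ → Ω → ℝ)

/-- The filter starts at zero and is driven only by the innovations. -/
theorem xhat_shat_mem_past (t : ℕ) :
    (∀ i, (fun ω => (S.loop (W ω) (fun τ => N τ ω) t).xhat i) ∈
      past (fun t ω => S.kalmanInnov (W ω) (fun τ => N τ ω) t) t) ∧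
    (∀ i, (fun ω => (S.loop (W ω) (fun τ => N τ ω) t).shat i) ∈
      past (fun t ω => S.kalmanInnov (W ω) (fun τ => N τ ω) t) t) := by
  induction t with
  | zero => exact ⟨fun i => Submodule.zero_mem _, fun i => Submodule.zero_mem _⟩
  | succ t ih =>
    set e := fun t ω => S.kalmanInnov (W ω) (fun τ => N τ ω) t
    have he : e t ∈ past e (t + 1) := mem_past (Nat.lt_succ_self t)
    have hle := past_mono e (Nat.le_succ t)
    refine ⟨fun i => ?_, fun i => ?_⟩
    · have h1 := Submodule.add_mem _ (hle (dotProduct_mem ih.1 (S.A i)))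
        (Submodule.smul_mem _ (S.gain t (Sum.inl i)) he)
      refine (congrArg (· ∈ past e (t + 1)) (funext fun ω => ?_)).mp h1
      rw [Pi.add_apply, Pi.smul_apply, smul_eq_mul, mul_comm]
      rfl
    · have h1 := Submodule.add_mem _ (hle (dotProduct_mem ih.2 (S.F i)))
        (Submodule.smul_mem _ (S.gain t (Sum.inr i)) he)
      refine (congrArg (· ∈ past e (t + 1)) (funext fun ω => ?_)).mp h1
      rw [Pi.add_apply, Pi.smul_apply, smul_eq_mul, mul_comm]
      rfl

variable {r ybar u y e : ℕ → Ω → ℝ}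
  (hr : r = fun t ω => S.source (W ω) t)
  (hybar : ybar = fun t ω => S.openOutput (W ω) (fun τ => N τ ω) t)
  (hu : u = fun t ω => S.kalmanInput (W ω) (fun τ => N τ ω) t)
  (hy : y = fun t ω => S.kalmanOutput (W ω) (fun τ => N τ ω) t)
  (he : e = fun t ω => S.kalmanInnov (W ω) (fun τ => N τ ω) t)

include hr hu he in
theorem source_sub_input_mem_past (t : ℕ) : r t - u t ∈ past e t := by
  have h1 := dotProduct_mem (S.xhat_shat_mem_past W N t).1 S.C
  rw [← he] at h1
  refine (congrArg (· ∈ past e t) (funext fun ω => ?_)).mp h1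
  simp [hr, hu, kalmanInput_eq_source_sub]

include hy he in
theorem output_sub_innov_mem_past (t : ℕ) : y t - e t ∈ past e t := by
  have h1 := dotProduct_mem (S.xhat_shat_mem_past W N t).2 S.H
  rw [← he] at h1
  refine (congrArg (· ∈ past e t) (funext fun ω => ?_)).mp h1
  simp [hy, he, kalmanInnov_eq_output_sub]

-- The same noise enters both outputs and cancels, leaving the channel response to `r - u`. The term
-- at time `t` itself is harmless, since `r t - u t` already lies in the past of `e`.
include hr hybar hu hy he in
theorem openOutput_sub_output_mem_past (t : ℕ) : ybar t - y t ∈ past e t := by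
  have h1 : ybar t - y t =
      ∑ j : Fin (t + 1), S.chanMatrix t (Fin.last t) j • (r j - u j) := by
    funext ω
    have h2 := S.openOutput_eq (W ω) (fun τ => N τ ω) t (Fin.last t)
    have h3 := S.kalmanOutput_eq (W ω) (fun τ => N τ ω) t (Fin.last t)
    simp only [Fin.val_last] at h2 h3
    simp only [hr, hybar, hu, hy, Pi.sub_apply, h2, h3, mulVec, dotProduct, Finset.sum_apply,
      Pi.smul_apply, smul_eq_mul, mul_sub, Finset.sum_sub_distrib]
    ring
  rw [h1]
  exact Submodule.sum_mem _ fun j _ => Submodule.smul_mem _ _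
    (past_mono e (Nat.lt_succ_iff.1 j.2) (S.source_sub_input_mem_past W N hr hu he j))

include hr hybar hu hy he in
theorem past_openOutput_eq (t : ℕ) : past ybar t = past e t :=
  past_eq_past fun s _ => by
    have h1 := Submodule.add_mem _ (S.openOutput_sub_output_mem_past W N hr hybar hu hy he s)
      (S.output_sub_innov_mem_past W N hy he s)
    simpa using h1

include hy he in
theorem past_output_eq (t : ℕ) : past y t = past e t :=
  past_eq_past fun s _ => S.output_sub_innov_mem_past W N hy he s

include hr hybar hu hy he in
theorem innov_sub_openOutput_mem_past (t : ℕ) : e t - ybar t ∈ past ybar t := by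
  rw [S.past_openOutput_eq W N hr hybar hu hy he]
  have h1 := Submodule.add_mem _ (S.openOutput_sub_output_mem_past W N hr hybar hu hy he t)
      (S.output_sub_innov_mem_past W N hy he t)
  simpa using Submodule.neg_mem _ h1

include hr hybar hu hy he in
theorem output_sub_openOutput_mem_past (t : ℕ) : y t - ybar t ∈ past ybar t := by
  rw [S.past_openOutput_eq W N hr hybar hu hy he]
  simpa using Submodule.neg_mem _ (S.openOutput_sub_output_mem_past W N hr hybar hu hy he t)

-- Feedback adds to the source a combination of earlier fed-back outputs, and these span the same
-- space as the earlier `ybar`. This makes all competing inputs comparable with `u`.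
include hybar in
theorem fbInput_sub_source_mem_past {T : ℕ} {K : Matrix (Fin (T + 1)) (Fin (T + 1)) ℝ}
    (hK : IsStrictlyLower K) (t : Fin (T + 1)) :
    (fun ω => S.fbInput T K (W ω) (fun τ => N τ ω) t - S.source (W ω) t) ∈ past ybar t := by
  -- The output vector becomes a process by setting it to zero after the horizon; only its values
  -- before `t` matter.
  set Y : ℕ → Ω → ℝ := fun s ω =>
    if hs : s < T + 1 then S.fbOutput T K (W ω) (fun τ => N τ ω) ⟨s, hs⟩ else 0 with hY
  have hYs : ∀ ω, firstSamples Y (T + 1) ω = S.fbOutput T K (W ω) (fun τ => N τ ω) := fun ω =>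
    funext fun s => dif_pos s.2
  have h1 : past ybar t = past Y t := by
    refine past_eq_past fun s hs => ?_
    have hs' : s < T + 1 := hs.trans t.2
    have h2 := Submodule.neg_mem _
      (mulVec_mem_past (Y := Y) (S.isStrictlyLower_chanMatrix_mul hK) ⟨s, hs'⟩)
    refine (congrArg (· ∈ past Y s) (funext fun ω => ?_)).mp h2
    have h3 := S.fbOutput_sub (W ω) (fun τ => N τ ω) hK ⟨s, hs'⟩
    simp only [Pi.neg_apply, hYs, ← h3]
    simp only [hY, hybar, Pi.sub_apply, dif_pos hs', neg_sub]
  rw [h1]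
  refine (congrArg (· ∈ past Y t) (funext fun ω => ?_)).mp (mulVec_mem_past hK t)
  rw [hYs]
  simp [fbInput]

-- Attainability: `u t - r t` lies in the past of `y`, and its coefficients form the required
-- strictly lower triangular matrix.
include hr hu hy he in
theorem exists_fbInput_eq_kalmanInput (T : ℕ) :
    ∃ K : Matrix (Fin (T + 1)) (Fin (T + 1)) ℝ, IsStrictlyLower K ∧
      ∀ ω, S.fbInput T K (W ω) (fun τ => N τ ω) = firstSamples u (T + 1) ω := by
  have h1 : ∀ t < T + 1, u t - r t ∈ past y t := fun t _ => by
    rw [S.past_output_eq W N hy he]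
    simpa using Submodule.neg_mem _ (S.source_sub_input_mem_past W N hr hu he t)
  obtain ⟨K, hK, hKy⟩ := exists_isStrictlyLower (X := fun t => u t - r t) h1
  refine ⟨K, hK, fun ω => ?_⟩
  have h2 : firstSamples y (T + 1) ω = S.fbOutput T K (W ω) (fun τ => N τ ω) := by
    refine S.eq_fbOutput _ _ hK fun t => ?_
    rw [← mulVec_mulVec]
    have h3 : K *ᵥ firstSamples y (T + 1) ω = (fun j : Fin (T + 1) => u j ω) -
        fun j : Fin (T + 1) => r j ω := funext fun j => (hKy ω j).symm
    rw [h3, mulVec_sub, Pi.sub_apply, S.openOutput_eq, firstSamples]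
    subst hy hr hu
    simp only [S.kalmanOutput_eq]
    ring
  funext t
  rw [fbInput, ← h2, Pi.add_apply, ← hKy]
  simp [firstSamples, hr]

end Processes

end Params

end FeedbackCoding

namespace FeedbackCoding

namespace Params

/-! ### Second moments of the coding system -/

variable {n m : ℕ} (S : Params n m)

/-- The variance of the innovation at time `t`, in terms of the Riccati recursion. -/
noncomputable def innovVar (t : ℕ) : ℝ := S.bigC ⬝ᵥ (S.ric t *ᵥ S.bigC) + 1

theorem ric_succ_apply (t : ℕ) (i j : Fin (n + 1) ⊕ Fin m) : S.ric (t + 1) i j =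
    S.bigA i ⬝ᵥ (S.ric t *ᵥ S.bigA j) - (S.innovVar t)⁻¹ *
      ((S.bigA i ⬝ᵥ (S.ric t *ᵥ S.bigC)) * (S.bigC ⬝ᵥ (S.ric t *ᵥ S.bigA j))) := by
  rw [ric, Matrix.sub_apply, Matrix.smul_apply, vecMulVec_apply, ← mulVec_mulVec, ← vecMul_vecMul,
    smul_eq_mul, Matrix.mul_assoc]
  have h1 : (S.bigC ᵥ* S.ric t ᵥ* S.bigAᵀ) j = S.bigC ⬝ᵥ (S.ric t *ᵥ S.bigA j) := by
    rw [dotProduct_mulVec]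
    rfl
  rw [h1]
  rfl

theorem gain_apply (t : ℕ) (i : Fin (n + 1) ⊕ Fin m) :
    S.gain t i = (S.innovVar t)⁻¹ * (S.bigA i ⬝ᵥ (S.ric t *ᵥ S.bigC)) := by
  rw [gain, Pi.smul_apply, ← mulVec_mulVec]
  rfl

section

variable {Ω : Type*} [MeasurableSpace Ω] {μ : Measure Ω} {W : Ω → Fin (n + 1) → ℝ}
  {N : ℕ → Ω → ℝ} {e : ℕ → Ω → ℝ} {X : ℕ → Ω → Fin (n + 1) ⊕ Fin m → ℝ}
  (h : IsGaussianModel μ W N)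
  (hX0 : ∀ ω, X 0 ω = Sum.elim (W ω) 0)
  (hX : ∀ t ω, X (t + 1) ω = S.bigA *ᵥ X t ω - e t ω • S.gain t)
  (he : ∀ t ω, e t ω = S.bigC ⬝ᵥ X t ω + N t ω)

include he in
omit [MeasurableSpace Ω] in
theorem innov_mem_of_error_mem {t : ℕ} (hXt : ∀ i, (fun ω => X t ω i) ∈ noiseSpan W N t) :
    e t ∈ noiseSpan W N (t + 1) := by
  have h1 := Submodule.add_mem _ (noiseSpan_mono (Nat.le_succ t) (dotProduct_mem hXt S.bigC))
    (noise_mem_noiseSpan (W := W) (N := N) (Nat.lt_succ_self t))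
  exact (congrArg (· ∈ noiseSpan W N (t + 1)) (funext fun ω => (he t ω).symm)).mp h1

include hX0 hX he in
omit [MeasurableSpace Ω] in
theorem error_mem_noiseSpan (t : ℕ) (i : Fin (n + 1) ⊕ Fin m) :
    (fun ω => X t ω i) ∈ noiseSpan W N t := by
  induction t generalizing i with
  | zero =>
    simp_rw [hX0]
    rcases i with i | i
    · exact message_mem_noiseSpan i 0
    · exact Submodule.zero_mem _
  | succ t ih =>
    have h1 := Submodule.sub_mem _ (noiseSpan_mono (Nat.le_succ t) (dotProduct_mem ih (S.bigA i)))
      (Submodule.smul_mem _ (S.gain t i) (S.innov_mem_of_error_mem he ih))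
    refine (congrArg (· ∈ noiseSpan W N (t + 1)) (funext fun ω => ?_)).mp h1
    rw [hX, Pi.sub_apply, Pi.sub_apply, Pi.smul_apply, Pi.smul_apply, smul_eq_mul, smul_eq_mul,
      mul_comm]
    rfl

include hX0 hX he in
omit [MeasurableSpace Ω] in
theorem innov_mem_noiseSpan (t : ℕ) : e t ∈ noiseSpan W N (t + 1) :=
  S.innov_mem_of_error_mem he (S.error_mem_noiseSpan hX0 hX he t)

include h hX0 hX he

omit h in
omit [MeasurableSpace Ω] in
theorem dotProduct_error_mem (t : ℕ) (a : Fin (n + 1) ⊕ Fin m → ℝ) :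
    (fun ω => a ⬝ᵥ X t ω) ∈ noiseSpan W N t :=
  dotProduct_mem (S.error_mem_noiseSpan hX0 hX he t) a

/-- This and the next three lemmas assume the covariance identity at the single time `t`, so that
they can serve inside the induction that proves it for all times. -/
theorem integral_dotProduct_mul_of_moments {t : ℕ}
    (hm : ∀ i j, ∫ ω, X t ω i * X t ω j ∂μ = S.ric t i j) (a b : Fin (n + 1) ⊕ Fin m → ℝ) :
    ∫ ω, (a ⬝ᵥ X t ω) * (b ⬝ᵥ X t ω) ∂μ = a ⬝ᵥ (S.ric t *ᵥ b) := by
  have h1 := integral_sum_mul_sum (μ := μ) (X := fun i ω => X t ω i) (Y := fun i ω => X t ω i)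
    (fun i j => h.integrable_mul (S.error_mem_noiseSpan hX0 hX he t i)
      (S.error_mem_noiseSpan hX0 hX he t j)) a b
  simp only [dotProduct, mulVec]
  rw [h1]
  refine Finset.sum_congr rfl fun i _ => ?_
  rw [Finset.mul_sum]
  refine Finset.sum_congr rfl fun j _ => ?_
  rw [hm]
  ring

theorem integral_dotProduct_mul_innov_of_moments {t : ℕ}
    (hm : ∀ i j, ∫ ω, X t ω i * X t ω j ∂μ = S.ric t i j) (a : Fin (n + 1) ⊕ Fin m → ℝ) :
    ∫ ω, (a ⬝ᵥ X t ω) * e t ω ∂μ = a ⬝ᵥ (S.ric t *ᵥ S.bigC) := by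
  have ha := S.dotProduct_error_mem hX0 hX he t a
  have hN : N t ∈ noiseSpan W N (t + 1) := noise_mem_noiseSpan (Nat.lt_succ_self t)
  simp_rw [he, mul_add]
  rw [integral_add (h.integrable_mul ha (S.dotProduct_error_mem hX0 hX he t S.bigC))
    (h.integrable_mul ha hN), h.integral_mul_noise le_rfl ha, add_zero,
    S.integral_dotProduct_mul_of_moments h hX0 hX he hm]

theorem integral_innov_mul_innov_of_moments {t : ℕ}
    (hm : ∀ i j, ∫ ω, X t ω i * X t ω j ∂μ = S.ric t i j) :
    ∫ ω, e t ω * e t ω ∂μ = S.innovVar t := by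
  have hc := S.dotProduct_error_mem hX0 hX he t S.bigC
  have hN : N t ∈ noiseSpan W N (t + 1) := noise_mem_noiseSpan (Nat.lt_succ_self t)
  have h1 : ∀ ω, e t ω * e t ω = (S.bigC ⬝ᵥ X t ω) * e t ω +
      ((S.bigC ⬝ᵥ X t ω) * N t ω + N t ω * N t ω) := fun ω => by
    rw [he]
    ring
  simp_rw [h1]
  have h2 : Integrable (fun ω => (S.bigC ⬝ᵥ X t ω) * N t ω + N t ω * N t ω) μ :=
    (h.integrable_mul hc hN).add (h.integrable_mul hN hN)
  rw [integral_add (h.integrable_mul hc (S.innov_mem_noiseSpan hX0 hX he t)) h2,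
    integral_add (h.integrable_mul hc hN) (h.integrable_mul hN hN),
    h.integral_mul_noise le_rfl hc, h.integral_noise_sq, zero_add,
    S.integral_dotProduct_mul_innov_of_moments h hX0 hX he hm, innovVar]

theorem innovVar_pos_of_moments {t : ℕ}
    (hm : ∀ i j, ∫ ω, X t ω i * X t ω j ∂μ = S.ric t i j) : 0 < S.innovVar t := by
  rw [innovVar, ← S.integral_dotProduct_mul_of_moments h hX0 hX he hm]
  have h1 : 0 ≤ ∫ ω, (S.bigC ⬝ᵥ X t ω) * (S.bigC ⬝ᵥ X t ω) ∂μ :=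
    integral_nonneg fun ω => mul_self_nonneg _
  linarith

/-- The product of two coordinates of `A X t - e t • gain t` is expanded; as the gain is the
regression coefficient of `A X t` on `e t`, the mean collapses to the Riccati step. -/
theorem integral_error_mul_error (t : ℕ) (i j : Fin (n + 1) ⊕ Fin m) :
    ∫ ω, X t ω i * X t ω j ∂μ = S.ric t i j := by
  induction t generalizing i j with
  | zero =>
    simp_rw [hX0]
    rcases i with i | i <;> rcases j with j | j <;> simp [ric, h.integral_message_mul]
  | succ t ih =>
    have hv := (S.innovVar_pos_of_moments h hX0 hX he ih).ne'
    have ha := fun i => S.dotProduct_error_mem hX0 hX he t (S.bigA i)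
    have hei := S.innov_mem_noiseSpan hX0 hX he t
    have hg : ∀ i, S.bigA i ⬝ᵥ (S.ric t *ᵥ S.bigC) = S.innovVar t * S.gain t i := fun i => by
      rw [gain_apply, mul_inv_cancel_left₀ hv]
    -- Symmetry of the Riccati matrix is read off from its role as a second-moment matrix.
    have hg' : S.bigC ⬝ᵥ (S.ric t *ᵥ S.bigA j) = S.innovVar t * S.gain t j := by
      rw [← hg, ← S.integral_dotProduct_mul_of_moments h hX0 hX he ih,
        ← S.integral_dotProduct_mul_of_moments h hX0 hX he ih]
      simp_rw [mul_comm]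
    have h1 : ∀ ω, X (t + 1) ω i * X (t + 1) ω j =
        (S.bigA i ⬝ᵥ X t ω) * (S.bigA j ⬝ᵥ X t ω) - S.gain t j * ((S.bigA i ⬝ᵥ X t ω) * e t ω) -
        S.gain t i * ((S.bigA j ⬝ᵥ X t ω) * e t ω) + S.gain t i * S.gain t j * (e t ω * e t ω) :=
      fun ω => by
        rw [hX]
        simp only [Pi.sub_apply, Pi.smul_apply, smul_eq_mul, mulVec]
        ring
    simp_rw [h1]
    have i1 := h.integrable_mul (ha i) (ha j)
    have i2 := (h.integrable_mul (ha i) hei).const_mul (S.gain t j)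
    have i3 := (h.integrable_mul (ha j) hei).const_mul (S.gain t i)
    have i4 := (h.integrable_mul hei hei).const_mul (S.gain t i * S.gain t j)
    have i12 : Integrable (fun ω => (S.bigA i ⬝ᵥ X t ω) * (S.bigA j ⬝ᵥ X t ω) -
        S.gain t j * ((S.bigA i ⬝ᵥ X t ω) * e t ω)) μ := i1.sub i2
    have i123 : Integrable (fun ω => (S.bigA i ⬝ᵥ X t ω) * (S.bigA j ⬝ᵥ X t ω) -
        S.gain t j * ((S.bigA i ⬝ᵥ X t ω) * e t ω) -
        S.gain t i * ((S.bigA j ⬝ᵥ X t ω) * e t ω)) μ := i12.sub i3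
    rw [integral_add i123 i4, integral_sub i12 i3, integral_sub i1 i2,
      integral_const_mul, integral_const_mul, integral_const_mul,
      S.integral_dotProduct_mul_of_moments h hX0 hX he ih,
      S.integral_dotProduct_mul_innov_of_moments h hX0 hX he ih,
      S.integral_dotProduct_mul_innov_of_moments h hX0 hX he ih,
      S.integral_innov_mul_innov_of_moments h hX0 hX he ih, ric_succ_apply, hg, hg, hg']
    field_simp
    ring

theorem integral_dotProduct_mul (t : ℕ) (a b : Fin (n + 1) ⊕ Fin m → ℝ) :
    ∫ ω, (a ⬝ᵥ X t ω) * (b ⬝ᵥ X t ω) ∂μ = a ⬝ᵥ (S.ric t *ᵥ b) :=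
  S.integral_dotProduct_mul_of_moments h hX0 hX he (S.integral_error_mul_error h hX0 hX he t) a b

theorem integral_innov_sq (t : ℕ) : ∫ ω, e t ω * e t ω ∂μ = S.innovVar t :=
  S.integral_innov_mul_innov_of_moments h hX0 hX he (S.integral_error_mul_error h hX0 hX he t)

theorem innovVar_pos (t : ℕ) : 0 < S.innovVar t :=
  S.innovVar_pos_of_moments h hX0 hX he (S.integral_error_mul_error h hX0 hX he t)

theorem integral_dotProduct_mul_innov_eq_zero {s t : ℕ} (hst : s < t)
    (a : Fin (n + 1) ⊕ Fin m → ℝ) : ∫ ω, (a ⬝ᵥ X t ω) * e s ω ∂μ = 0 := by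
  have hes := S.innov_mem_noiseSpan hX0 hX he s
  have hlin : ∀ t, (∀ i, ∫ ω, X t ω i * e s ω ∂μ = 0) → ∀ a : Fin (n + 1) ⊕ Fin m → ℝ,
      ∫ ω, (a ⬝ᵥ X t ω) * e s ω ∂μ = 0 := fun t ht a => by
    simp only [dotProduct, Finset.sum_mul, mul_assoc]
    rw [integral_finsetSum _ fun i _ =>
      (h.integrable_mul (S.error_mem_noiseSpan hX0 hX he t i) hes).const_mul _]
    exact Finset.sum_eq_zero fun i _ => by rw [integral_const_mul, ht, mul_zero]
  refine hlin t (fun i => ?_) a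
  have hstep : ∀ t i ω, X (t + 1) ω i * e s ω =
      (S.bigA i ⬝ᵥ X t ω) * e s ω - S.gain t i * (e t ω * e s ω) := fun t i ω => by
    rw [hX]
    simp only [Pi.sub_apply, Pi.smul_apply, smul_eq_mul, mulVec]
    ring
  have hint := fun t i => h.integrable_mul (S.dotProduct_error_mem hX0 hX he t (S.bigA i)) hes
  have hint' := fun t i =>
    (h.integrable_mul (S.innov_mem_noiseSpan hX0 hX he t) hes).const_mul (S.gain t i)
  induction t, hst using Nat.le_induction generalizing i with
  | base =>
    -- At time `s + 1` the gain subtracts exactly the regression on `e s`; at later times the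
    -- recursion only adds noise that is uncorrelated with `e s`.
    simp_rw [hstep]
    rw [integral_sub (hint s i) (hint' s i), integral_const_mul,
      S.integral_innov_sq h hX0 hX he,
      S.integral_dotProduct_mul_innov_of_moments h hX0 hX he
        (S.integral_error_mul_error h hX0 hX he s), gain_apply]
    field_simp [(S.innovVar_pos h hX0 hX he s).ne']
    ring
  | succ t hst ih =>
    simp_rw [hstep]
    rw [integral_sub (hint t i) (hint' t i), hlin t ih, integral_const_mul]
    simp_rw [he t, add_mul]
    rw [integral_add (h.integrable_mul (S.dotProduct_error_mem hX0 hX he t S.bigC) hes)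
      (h.integrable_mul (noise_mem_noiseSpan (Nat.lt_succ_self t)) hes), hlin t ih]
    simp_rw [mul_comm (N t _)]
    rw [h.integral_mul_noise hst hes]
    simp

theorem integral_innov_mul_innov_of_lt {s t : ℕ} (hst : s < t) :
    ∫ ω, e t ω * e s ω ∂μ = 0 := by
  have hes := S.innov_mem_noiseSpan hX0 hX he s
  simp_rw [he t, add_mul]
  rw [integral_add (h.integrable_mul (S.dotProduct_error_mem hX0 hX he t S.bigC) hes)
    (h.integrable_mul (noise_mem_noiseSpan (Nat.lt_succ_self t)) hes),
    S.integral_dotProduct_mul_innov_eq_zero h hX0 hX he hst]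
  simp_rw [mul_comm (N t _)]
  rw [h.integral_mul_noise hst hes, add_zero]

theorem integral_innov_mul_innov_of_ne {s t : ℕ} (hst : s ≠ t) :
    ∫ ω, e s ω * e t ω ∂μ = 0 := by
  rcases hst.lt_or_gt with hlt | hlt
  · simp_rw [mul_comm (e s _)]
    exact S.integral_innov_mul_innov_of_lt h hX0 hX he hlt
  · exact S.integral_innov_mul_innov_of_lt h hX0 hX he hlt

theorem integral_dotProduct_mul_past (t : ℕ) (a : Fin (n + 1) ⊕ Fin m → ℝ) {Z : Ω → ℝ}
    (hZ : Z ∈ past e t) : ∫ ω, (a ⬝ᵥ X t ω) * Z ω ∂μ = 0 := by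
  obtain ⟨b, hb⟩ := exists_coeff_of_mem_past hZ
  have ha := S.dotProduct_error_mem hX0 hX he t a
  simp_rw [hb, Finset.mul_sum, mul_left_comm _ (b _)]
  rw [integral_finsetSum _ fun (j : Fin t) _ =>
    (h.integrable_mul ha (S.innov_mem_noiseSpan hX0 hX he j)).const_mul (b j)]
  refine Finset.sum_eq_zero fun j _ => ?_
  rw [integral_const_mul, S.integral_dotProduct_mul_innov_eq_zero h hX0 hX he j.2, mul_zero]

theorem covMatrix_innov (T : ℕ) :
    covMatrix μ e T = Matrix.diagonal fun t : Fin (T + 1) => S.innovVar t := by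
  have := h.isProbabilityMeasure
  have hme := S.innov_mem_noiseSpan hX0 hX he
  ext i j
  rw [covMatrix, of_apply, covariance_eq_sub (h.memLp_two (hme i)) (h.memLp_two (hme j)),
    h.integral_eq_zero (hme i), zero_mul, sub_zero]
  by_cases hij : i = j
  · subst hij
    rw [diagonal_apply_eq]
    exact S.integral_innov_sq h hX0 hX he i
  · rw [diagonal_apply_ne _ hij]
    exact S.integral_innov_mul_innov_of_ne h hX0 hX he fun hc => hij (Fin.ext hc)

/-- The innovations are jointly Gaussian and uncorrelated, hence independent, and each law is fixed
by its mean and variance. -/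
theorem law_innov (k : ℕ) : μ.map (firstSamples e k) =
    Measure.pi fun t : Fin k => gaussianReal 0 (S.innovVar t).toNNReal := by
  have := h.isProbabilityMeasure
  have hme := S.innov_mem_noiseSpan hX0 hX he
  have hind : iIndepFun (fun (t : Fin k) => e t) μ := by
    refine HasGaussianLaw.iIndepFun_of_covariance_eq_zero (h.hasGaussianLaw_pi (t := k)
      fun i => noiseSpan_mono i.2 (hme i)) fun i j hij => ?_
    rw [covariance_eq_sub (h.memLp_two (hme i)) (h.memLp_two (hme j)),
      h.integral_eq_zero (hme i), zero_mul, sub_zero]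
    exact S.integral_innov_mul_innov_of_ne h hX0 hX he fun hc => hij (Fin.ext hc)
  have h1 := iIndepFun.map_fun_eq_pi_map (f := fun (t : Fin k) => e t)
    (fun i => (h.measurable (hme i)).aemeasurable) hind
  refine h1.trans ?_
  congr 1
  funext i
  rw [(h.hasGaussianLaw (hme i)).map_eq_gaussianReal, h.integral_eq_zero (hme i),
    variance_eq_integral (h.measurable (hme i)).aemeasurable, h.integral_eq_zero (hme i)]
  simp_rw [sub_zero, sq]
  rw [S.integral_innov_sq h hX0 hX he]

end

end Params

end FeedbackCoding

namespace FeedbackCoding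

/-! ### The linear Gaussian observation model -/

theorem pi_gaussianReal_eq_withDensity {ι : Type*} [Fintype ι] {v : ι → NNReal}
    (hv : ∀ i, v i ≠ 0) :
    Measure.pi (fun i => gaussianReal 0 (v i)) = (volume : Measure (ι → ℝ)).withDensity
      fun x => ENNReal.ofReal (∏ i, gaussianPDFReal 0 (v i) (x i)) := by
  have h1 : ∀ i, gaussianReal 0 (v i) = (volume : Measure ℝ).withDensity
      fun x => ENNReal.ofReal (gaussianPDFReal 0 (v i) x) := fun i =>
    gaussianReal_of_var_ne_zero 0 (hv i)
  have h2 : ∀ i, SigmaFinite ((volume : Measure ℝ).withDensity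
      fun x => ENNReal.ofReal (gaussianPDFReal 0 (v i) x)) := fun i => by
    rw [← h1]
    infer_instance
  simp_rw [h1]
  exact pi_withDensity_ofReal (fun i => gaussianPDFReal 0 (v i))
    (fun i x => gaussianPDFReal_nonneg 0 (v i) x)
    (fun i => integrable_gaussianPDFReal 0 (v i))

theorem log_gaussianPDFReal {v : NNReal} (hv : v ≠ 0) (x : ℝ) :
    Real.log (gaussianPDFReal 0 v x) =
      -(1 / 2) * Real.log (2 * Real.pi) - 1 / 2 * Real.log v - x ^ 2 / (2 * v) := by
  have hv' : (0 : ℝ) < v := by positivity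
  have hpi : (0 : ℝ) < 2 * Real.pi := by positivity
  rw [gaussianPDFReal_def, Real.log_mul (by positivity) (Real.exp_ne_zero _), Real.log_exp,
    Real.log_inv, Real.log_sqrt (by positivity), Real.log_mul hpi.ne' hv'.ne', sub_zero]
  ring

variable {d k : ℕ}

/-- The joint density of a standard Gaussian `w` and `y = B w + noise`. -/
noncomputable def jointDensity (B : Matrix (Fin k) (Fin d) ℝ)
    (z : (Fin d → ℝ) × (Fin k → ℝ)) : ℝ :=
  (∏ i, gaussianPDFReal 0 1 (z.1 i)) * ∏ t, gaussianPDFReal 0 1 ((z.2 - B *ᵥ z.1) t)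

theorem jointDensity_pos (B : Matrix (Fin k) (Fin d) ℝ) (z : (Fin d → ℝ) × (Fin k → ℝ)) :
    0 < jointDensity B z :=
  mul_pos (Finset.prod_pos fun _ _ => gaussianPDFReal_pos _ _ _ one_ne_zero)
    (Finset.prod_pos fun _ _ => gaussianPDFReal_pos _ _ _ one_ne_zero)

theorem contDiff_jointDensity (B : Matrix (Fin k) (Fin d) ℝ) : ContDiff ℝ 1 (jointDensity B) := by
  have hg : ContDiff ℝ 1 (gaussianPDFReal 0 1) := by
    rw [gaussianPDFReal_def]
    fun_prop
  have hB : ContDiff ℝ 1 fun w : Fin d → ℝ => B *ᵥ w :=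
    (LinearMap.toContinuousLinearMap (Matrix.mulVecLin B)).contDiff
  refine ContDiff.mul (contDiff_prod fun i _ => hg.comp (by fun_prop))
    (contDiff_prod fun t _ => hg.comp ?_)
  exact contDiff_pi.1 (contDiff_snd.sub (hB.comp contDiff_fst)) t

theorem log_jointDensity (B : Matrix (Fin k) (Fin d) ℝ) (z : (Fin d → ℝ) × (Fin k → ℝ)) :
    Real.log (jointDensity B z) = ∑ i, Real.log (gaussianPDFReal 0 1 (z.1 i)) +
      ∑ t, Real.log (gaussianPDFReal 0 1 ((z.2 - B *ᵥ z.1) t)) := by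
  have hp : ∀ x, gaussianPDFReal 0 1 x ≠ 0 := fun x =>
    (gaussianPDFReal_pos 0 1 x one_ne_zero).ne'
  rw [jointDensity, Real.log_mul (Finset.prod_ne_zero_iff.2 fun i _ => hp _)
    (Finset.prod_ne_zero_iff.2 fun i _ => hp _), Real.log_prod fun i _ => hp _,
    Real.log_prod fun i _ => hp _]

theorem log_jointDensity_eq (B : Matrix (Fin k) (Fin d) ℝ) (z : (Fin d → ℝ) × (Fin k → ℝ)) :
    Real.log (jointDensity B z) = -((d + k) * (1 / 2 * Real.log (2 * Real.pi))) -
      1 / 2 * (z.1 ⬝ᵥ z.1 + (z.2 - B *ᵥ z.1) ⬝ᵥ (z.2 - B *ᵥ z.1)) := by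
  rw [log_jointDensity]
  simp only [log_gaussianPDFReal one_ne_zero, NNReal.coe_one, Real.log_one, Finset.sum_sub_distrib,
    Finset.sum_const, Finset.card_univ, Fintype.card_fin, nsmul_eq_mul, ← Finset.sum_div,
    dotProduct, sq]
  ring

/-- The score of the joint density. -/
theorem score_jointDensity (B : Matrix (Fin k) (Fin d) ℝ) (i : Fin d)
    (z : (Fin d → ℝ) × (Fin k → ℝ)) :
    score (jointDensity B) i z = Bᵀ i ⬝ᵥ (z.2 - B *ᵥ z.1) - z.1 i := by
  obtain ⟨w, y⟩ := z
  rw [score, lineDeriv]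
  have hcol : B *ᵥ (Pi.single i (1 : ℝ)) = Bᵀ i := by
    rw [mulVec_single_one]
    rfl
  -- Along a coordinate line the log-density is a quadratic polynomial, so the score is its linear
  -- coefficient.
  have h1 : ∀ t : ℝ, Real.log (jointDensity B (w + t • Pi.single i 1, y)) =
      Real.log (jointDensity B (w, y)) + (Bᵀ i ⬝ᵥ (y - B *ᵥ w) - w i) * t -
        1 / 2 * (1 + Bᵀ i ⬝ᵥ Bᵀ i) * t ^ 2 := fun t => by
    rw [log_jointDensity_eq, log_jointDensity_eq]
    have h2 : y - B *ᵥ (w + t • Pi.single i 1) = (y - B *ᵥ w) - t • Bᵀ i := by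
      rw [mulVec_add, mulVec_smul, hcol, sub_sub]
    simp only [h2, add_dotProduct, dotProduct_add, sub_dotProduct, dotProduct_sub, smul_dotProduct,
      dotProduct_smul, smul_eq_mul, single_one_dotProduct, dotProduct_single_one,
      Pi.add_apply, Pi.smul_apply, Pi.single_eq_same]
    rw [dotProduct_comm y (Bᵀ i), dotProduct_comm (B *ᵥ w) (Bᵀ i)]
    ring
  simp only [h1]
  have h3 : HasDerivAt (fun t : ℝ => Real.log (jointDensity B (w, y)) +
      (Bᵀ i ⬝ᵥ (y - B *ᵥ w) - w i) * t - 1 / 2 * (1 + Bᵀ i ⬝ᵥ Bᵀ i) * t ^ 2)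
      ((Bᵀ i ⬝ᵥ (y - B *ᵥ w) - w i) * 1 -
        1 / 2 * (1 + Bᵀ i ⬝ᵥ Bᵀ i) * ((2 : ℕ) * (0 : ℝ) ^ (2 - 1) * 1)) 0 :=
    (((hasDerivAt_id (0 : ℝ)).const_mul _).const_add _).sub
      (((hasDerivAt_id (0 : ℝ)).pow 2).const_mul _)
  rw [h3.deriv]
  simp

/-- The two densities agree almost everywhere, and continuity upgrades this to equality. Claims
about every regular density thus reduce to `jointDensity`. -/
theorem IsRegularDensity.unique {p q : ℕ} {ρ : Measure ((Fin p → ℝ) × (Fin q → ℝ))}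
    {f g : (Fin p → ℝ) × (Fin q → ℝ) → ℝ} (hf : IsRegularDensity ρ f)
    (hg : IsRegularDensity ρ g) : f = g := by
  have hfc := hf.contDiff.continuous
  have hgc := hg.contDiff.continuous
  have h1 := hf.law.symm.trans hg.law
  rw [withDensity_eq_iff_of_sigmaFinite (by fun_prop) (by fun_prop)] at h1
  refine (Continuous.ae_eq_iff_eq volume hfc hgc).1 ?_
  filter_upwards [h1] with z hz
  exact (ENNReal.ofReal_eq_ofReal_iff (hf.pos z).le (hg.pos z).le).1 hz

/-! ### Density, Fisher information, MMSE and mutual information for `Y = B W + N` -/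

namespace IsGaussianModel

variable {Ω : Type*} [MeasurableSpace Ω] {μ : Measure Ω} {W : Ω → Fin d → ℝ} {N : ℕ → Ω → ℝ}
  (h : IsGaussianModel μ W N) {B : Matrix (Fin k) (Fin d) ℝ} {Y : ℕ → Ω → ℝ}
  (hY : ∀ ω (t : Fin k), Y t ω = (B *ᵥ W ω) t + N t ω)

include hY in
omit [MeasurableSpace Ω] in
theorem firstSamples_eq (ω : Ω) :
    firstSamples Y k ω = B *ᵥ W ω + fun τ : Fin k => N τ ω := funext fun t => hY ω t

include h hY

theorem measurable_firstSamples : Measurable (firstSamples Y k) := by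
  have hB : Measurable fun w : Fin d → ℝ => B *ᵥ w :=
    (LinearMap.continuous_of_finiteDimensional (Matrix.mulVecLin B)).measurable
  rw [funext (firstSamples_eq hY)]
  exact (hB.comp h.measurable_message).add (h.measurable_samples k)

theorem isRegularDensity_jointDensity :
    IsRegularDensity (μ.map fun ω => (W ω, firstSamples Y k ω)) (jointDensity B) := by
  refine ⟨jointDensity_pos B, contDiff_jointDensity B, ?_⟩
  -- The shear subtracts its matrix term, so `-B` is the one that sends `(W, N)` to `(W, B W + N)`.
  have hmp := measurePreserving_shear (-B)
  have h1 : (μ.map fun ω => (W ω, firstSamples Y k ω)) =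
      (μ.map fun ω => (W ω, fun τ : Fin k => N τ ω)).map
        fun z : (Fin d → ℝ) × (Fin k → ℝ) => (z.1, z.2 - (-B) *ᵥ z.1) := by
    rw [Measure.map_map hmp.measurable (h.measurable_message.prodMk (h.measurable_samples k))]
    congr 1
    funext ω
    simp only [Function.comp, firstSamples_eq hY, neg_mulVec, sub_neg_eq_add, add_comm]
  have hf : Measurable (jointDensity B) := (contDiff_jointDensity B).continuous.measurable
  rw [h1, h.law_joint, pi_gaussianReal_eq_withDensity fun _ => one_ne_zero,
    pi_gaussianReal_eq_withDensity fun _ => one_ne_zero,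
    prod_withDensity (by fun_prop) (by fun_prop), ← Measure.volume_eq_prod,
    ← map_withDensity_comp hmp (f := fun z => ENNReal.ofReal (jointDensity B z)) (by fun_prop)]
  congr 2
  funext z
  rw [← ENNReal.ofReal_mul (Finset.prod_nonneg fun i _ => gaussianPDFReal_nonneg _ _ _)]
  simp only [Function.comp, jointDensity, neg_mulVec, sub_neg_eq_add, add_sub_cancel_right]

omit h in
omit [MeasurableSpace Ω] in
theorem score_comp (i : Fin d) (ω : Ω) :
    score (jointDensity B) i (W ω, firstSamples Y k ω) =
      (-(Pi.single i 1)) ⬝ᵥ W ω + Bᵀ i ⬝ᵥ fun τ : Fin k => N τ ω := by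
  rw [score_jointDensity, firstSamples_eq hY, add_sub_cancel_left, neg_dotProduct,
    single_one_dotProduct]
  ring

omit h hY in
omit [MeasurableSpace Ω] in
theorem linear_mem (a : Fin d → ℝ) (b : Fin k → ℝ) :
    (fun ω => a ⬝ᵥ W ω + b ⬝ᵥ fun τ : Fin k => N τ ω) ∈ noiseSpan W N k :=
  Submodule.add_mem _ (dotProduct_mem (fun i => message_mem_noiseSpan i k) a)
    (dotProduct_mem (fun τ => noise_mem_noiseSpan τ.2) b)

/-- On the sample the score is `Bᵀ N - W`, whose covariance is `Bᵀ B + 1`. -/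
theorem integrable_score_mul (i j : Fin d) :
    Integrable (fun z => score (jointDensity B) i z * score (jointDensity B) j z)
      (μ.map fun ω => (W ω, firstSamples Y k ω)) ∧
    ∫ z, score (jointDensity B) i z * score (jointDensity B) j z
      ∂(μ.map fun ω => (W ω, firstSamples Y k ω)) = (1 + Bᵀ * B : Matrix (Fin d) (Fin d) ℝ) i j := by
  have hB : Continuous fun w : Fin d → ℝ => B *ᵥ w :=
    LinearMap.continuous_of_finiteDimensional (Matrix.mulVecLin B)
  have hs : ∀ i, Continuous (score (jointDensity B) i) := fun i => by
    rw [funext (score_jointDensity B i)]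
    exact (continuous_const.dotProduct (continuous_snd.sub (hB.comp continuous_fst))).sub
      ((continuous_apply i).comp continuous_fst)
  have hm : AEMeasurable (fun ω => (W ω, firstSamples Y k ω)) μ :=
    (h.measurable_message.prodMk (h.measurable_firstSamples hY)).aemeasurable
  have hss : AEStronglyMeasurable
      (fun z => score (jointDensity B) i z * score (jointDensity B) j z)
      (μ.map fun ω => (W ω, firstSamples Y k ω)) :=
    ((hs i).mul (hs j)).measurable.aestronglyMeasurable
  refine ⟨?_, ?_⟩
  · rw [integrable_map_measure hss hm]
    simp only [Function.comp_def, score_comp hY]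
    exact h.integrable_mul (linear_mem _ _) (linear_mem _ _)
  · rw [integral_map hm hss]
    simp only [score_comp hY]
    rw [h.integral_linear_mul, neg_dotProduct, dotProduct_neg, neg_neg, single_one_dotProduct,
      Matrix.add_apply, Matrix.one_apply, Pi.single_apply]
    rfl

theorem bayesFisher_eq :
    bayesFisher (μ.map fun ω => (W ω, firstSamples Y k ω)) (jointDensity B) = 1 + Bᵀ * B := by
  ext i j
  exact (h.integrable_score_mul hY i j).2

omit h hY [MeasurableSpace Ω] in
theorem posDef_one_add (B : Matrix (Fin k) (Fin d) ℝ) : (1 + Bᵀ * B).PosDef := by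
  have h1 := Matrix.posSemidef_conjTranspose_mul_self B
  rw [conjTranspose_eq_transpose_of_trivial] at h1
  exact Matrix.PosDef.one.add_posSemidef h1

/-- With `R = (1 + Bᵀ B)⁻¹`, the estimator `R Bᵀ Y` has error `D = R W - R Bᵀ N`. This error is
uncorrelated with `Y`, and its covariance `R Rᵀ + R Bᵀ B Rᵀ` equals `R`. -/
theorem mmse_eq : mmse μ W (firstSamples Y k) = (1 + Bᵀ * B)⁻¹ := by
  have := h.isProbabilityMeasure
  have hdet : IsUnit (1 + Bᵀ * B).det := (posDef_one_add B).det_pos.ne'.isUnit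
  set R := (1 + Bᵀ * B)⁻¹ with hR
  have hR1 : R * (1 + Bᵀ * B) = 1 := Matrix.nonsing_inv_mul _ hdet
  have hRt : Rᵀ = R := by
    rw [hR, transpose_nonsing_inv]
    simp
  set D : Fin d → Ω → ℝ := fun i ω =>
    R i ⬝ᵥ W ω + (-(R * Bᵀ) i) ⬝ᵥ fun τ : Fin k => N τ ω with hD
  have hYl : ∀ (j : Fin k) ω, Y j ω = B j ⬝ᵥ W ω +
      Pi.single j 1 ⬝ᵥ fun τ : Fin k => N τ ω := fun j ω => by
    rw [hY, single_one_dotProduct]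
    rfl
  have hDm : ∀ i, D i ∈ noiseSpan W N k := fun i => linear_mem _ _
  have hYm : ∀ j : Fin k, Y j ∈ noiseSpan W N k := fun j => by
    rw [funext (hYl j)]
    exact linear_mem _ _
  have hcm : ∀ i, condMean μ (fun ω => W ω i) (firstSamples Y k) =ᵐ[μ]
      fun ω => W ω i - D i ω := fun i => by
    refine condMean_ae_eq (Y := fun j : Fin k => Y j) (fun j => h.measurable (hYm j))
      (h.measurable (hDm i))
      (h.hasGaussianLaw_prod (X := fun _ : Fin 1 => D i) (fun _ => hDm i) hYm)
      (h.integral_eq_zero (hDm i)) (fun j => ?_) ⟨(R * Bᵀ) i, fun ω => ?_⟩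
    · simp_rw [hYl, hD]
      rw [h.integral_linear_mul, dotProduct_single_one]
      exact add_neg_cancel _
    · have h2 : R * Bᵀ * B = 1 - R := by
        rw [← hR1, Matrix.mul_add, Matrix.mul_assoc]
        simp
      have h3 : ∑ j, (R * Bᵀ) i j * Y j ω = ((R * Bᵀ) *ᵥ firstSamples Y k ω) i := rfl
      rw [h3, firstSamples_eq hY, mulVec_add, mulVec_mulVec, h2, sub_mulVec, one_mulVec]
      simp only [hD, Pi.add_apply, Pi.sub_apply, neg_dotProduct, mulVec]
      ring
  have h4 : R * Rᵀ + (R * Bᵀ) * (R * Bᵀ)ᵀ = R := by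
    rw [transpose_mul, transpose_transpose, hRt]
    calc R * R + R * Bᵀ * (B * R) = R * (1 + Bᵀ * B) * R := by
          simp only [Matrix.mul_add, Matrix.add_mul, Matrix.mul_assoc, Matrix.mul_one]
      _ = R := by rw [hR1, Matrix.one_mul]
  ext i j
  rw [mmse, of_apply]
  have h5 : (fun ω => (W ω i - condMean μ (fun ω' => W ω' i) (firstSamples Y k) ω) *
      (W ω j - condMean μ (fun ω' => W ω' j) (firstSamples Y k) ω)) =ᵐ[μ]
      fun ω => D i ω * D j ω := by
    filter_upwards [hcm i, hcm j] with ω h1 h2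
    rw [h1, h2]
    ring
  rw [integral_congr_ae h5]
  simp only [hD]
  rw [h.integral_linear_mul, neg_dotProduct, dotProduct_neg, neg_neg]
  exact congrFun (congrFun h4 i) j

variable {M : Matrix (Fin k) (Fin k) ℝ} (hM : M.det = 1) {e : Fin k → Ω → ℝ} {v : Fin k → ℝ}
  (heM : ∀ ω, (fun t => e t ω) = M *ᵥ firstSamples Y k ω)

omit h in
include heM in
omit [MeasurableSpace Ω] in
theorem whitening_eq_linear (t : Fin k) (ω : Ω) :
    e t ω = (M * B) t ⬝ᵥ W ω + M t ⬝ᵥ fun τ : Fin k => N τ ω := by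
  have h1 := congrFun (heM ω) t
  rw [firstSamples_eq hY, mulVec_add, mulVec_mulVec] at h1
  exact h1

-- Whitening diagonalizes the output covariance `1 + B Bᵀ` without changing its determinant.
include hM heM in
theorem det_eq_prod_of_whitening
    (hv : ∀ i j, ∫ ω, e i ω * e j ω ∂μ = Matrix.diagonal v i j) :
    (1 + Bᵀ * B).det = ∏ t, v t := by
  have h1 : M * (1 + B * Bᵀ) * Mᵀ = Matrix.diagonal v := by
    ext i j
    rw [← hv]
    simp_rw [whitening_eq_linear hY heM]
    rw [h.integral_linear_mul]
    have h2 : M * (1 + B * Bᵀ) * Mᵀ = (M * B) * (M * B)ᵀ + M * Mᵀ := by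
      simp only [transpose_mul, Matrix.mul_add, Matrix.add_mul, Matrix.mul_assoc, Matrix.mul_one]
      rw [add_comm]
    rw [h2]
    rfl
  rw [← Matrix.det_diagonal, ← h1, Matrix.det_mul, Matrix.det_mul, Matrix.det_transpose, hM,
    one_mul, mul_one, Matrix.det_one_add_mul_comm]

include hM heM in
theorem mutualInfo_of_whitening (hv0 : ∀ t, 0 < v t)
    (hv : ∀ t, ∫ ω, e t ω * e t ω ∂μ = v t)
    (hlaw : μ.map (fun ω t => e t ω) = Measure.pi fun t => gaussianReal 0 (v t).toNNReal) :
    mutualInfo μ W (firstSamples Y k) ≠ ⊤ ∧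
      (mutualInfo μ W (firstSamples Y k)).toReal = 1 / 2 * ∑ t, Real.log (v t) := by
  have := h.isProbabilityMeasure
  have hYm := h.measurable_firstSamples hY
  have hp1 : IsProbabilityMeasure (μ.map fun ω => (W ω, firstSamples Y k ω)) :=
    Measure.isProbabilityMeasure_map (h.measurable_message.prodMk hYm).aemeasurable
  have hp2 : IsProbabilityMeasure (μ.map W) :=
    Measure.isProbabilityMeasure_map h.measurable_message.aemeasurable
  have hp3 : IsProbabilityMeasure (μ.map (firstSamples Y k)) :=
    Measure.isProbabilityMeasure_map hYm.aemeasurable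
  have hv1 : ∀ t, (v t).toNNReal ≠ 0 := fun t => by simpa using hv0 t
  have hMu : IsUnit M.det := by simp [hM]
  have hem : ∀ t, e t ∈ noiseSpan W N k := fun t => by
    rw [funext (whitening_eq_linear hY heM t)]
    exact linear_mem _ _
  have hMi : M⁻¹.det = 1 := by simp [Matrix.det_nonsing_inv, hM]
  have hmeas : ∀ A : Matrix (Fin k) (Fin k) ℝ, Measurable fun y : Fin k → ℝ => A *ᵥ y := fun A =>
    (LinearMap.continuous_of_finiteDimensional (Matrix.mulVecLin A)).measurable
  set q : (Fin k → ℝ) → ℝ := fun x => ∏ t, gaussianPDFReal 0 (v t).toNNReal (x t) with hq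
  have hqm : Measurable q := by fun_prop
  have hq0 : ∀ x, 0 < q x := fun x =>
    Finset.prod_pos fun t _ => gaussianPDFReal_pos _ _ _ (hv1 t)
  have hlawY : μ.map (firstSamples Y k) =
      volume.withDensity fun y => ENNReal.ofReal (q (M *ᵥ y)) := by
    have h1 : μ.map (firstSamples Y k) = (μ.map fun ω t => e t ω).map fun x => M⁻¹ *ᵥ x := by
      rw [Measure.map_map (hmeas _) (measurable_pi_lambda _ fun t => h.measurable (hem t))]
      congr 1
      funext ω
      simp only [Function.comp, heM, mulVec_mulVec, Matrix.nonsing_inv_mul _ hMu, one_mulVec]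
    rw [h1, hlaw, pi_gaussianReal_eq_withDensity hv1,
      ← map_withDensity_comp (measurePreserving_mulVec hMi)
        (f := fun y => ENNReal.ofReal (q (M *ᵥ y))) (hqm.comp (hmeas M)).ennreal_ofReal]
    congr 2
    funext x
    simp only [Function.comp, mulVec_mulVec, Matrix.mul_nonsing_inv _ hMu, one_mulVec, hq]
  have hf : Measurable (jointDensity B) := (contDiff_jointDensity B).continuous.measurable
  set g : (Fin d → ℝ) × (Fin k → ℝ) → ℝ := fun z =>
    (∏ i, gaussianPDFReal 0 1 (z.1 i)) * q (M *ᵥ z.2) with hg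
  have hpm : Measurable fun w : Fin d → ℝ => ∏ i, gaussianPDFReal 0 1 (w i) := by fun_prop
  have hqM : Measurable fun y : Fin k → ℝ => q (M *ᵥ y) := hqm.comp (hmeas M)
  have hgm : Measurable g := (hpm.comp measurable_fst).mul (hqM.comp measurable_snd)
  have hp0 : ∀ w : Fin d → ℝ, 0 < ∏ i, gaussianPDFReal 0 1 (w i) := fun w =>
    Finset.prod_pos fun _ _ => gaussianPDFReal_pos _ _ _ one_ne_zero
  have hg0 : ∀ z, 0 < g z := fun z => mul_pos (hp0 _) (hq0 _)
  have hprod : (μ.map W).prod (μ.map (firstSamples Y k)) =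
      volume.withDensity fun z => ENNReal.ofReal (g z) := by
    rw [hlawY, h.law_message, pi_gaussianReal_eq_withDensity fun _ => one_ne_zero,
      prod_withDensity hpm.ennreal_ofReal hqM.ennreal_ofReal, ← Measure.volume_eq_prod]
    congr 1
    funext z
    rw [← ENNReal.ofReal_mul (hp0 _).le]
  -- The Gaussian prior of `W` cancels between joint and product densities; what remains compares
  -- the noise density at `N t` with the innovation density at `e t`.
  have hlog : ∀ ω, Real.log (jointDensity B (W ω, firstSamples Y k ω)) -
      Real.log (g (W ω, firstSamples Y k ω)) =
      ∑ t, (1 / 2 * Real.log (v t) + (e t ω * e t ω / (2 * v t) - N t ω * N t ω / 2)) :=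
    fun ω => by
      have hlogg : Real.log (g (W ω, firstSamples Y k ω)) =
          ∑ i, Real.log (gaussianPDFReal 0 1 (W ω i)) +
            ∑ t, Real.log (gaussianPDFReal 0 (v t).toNNReal (e t ω)) := by
        rw [hg, Real.log_mul (hp0 _).ne' (hq0 _).ne', hq, ← heM,
          Real.log_prod fun i _ => (gaussianPDFReal_pos _ _ _ one_ne_zero).ne',
          Real.log_prod fun t _ => (gaussianPDFReal_pos _ _ _ (hv1 t)).ne']
      rw [log_jointDensity, hlogg, add_sub_add_left_eq_sub, ← Finset.sum_sub_distrib]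
      refine Finset.sum_congr rfl fun t _ => ?_
      rw [log_gaussianPDFReal one_ne_zero, log_gaussianPDFReal (hv1 t),
        Real.coe_toNNReal _ (hv0 t).le, firstSamples_eq hY]
      simp only [add_sub_cancel_left, NNReal.coe_one, Real.log_one]
      ring
  have hlm : Measurable fun z => Real.log (jointDensity B z) - Real.log (g z) := by fun_prop
  have i1 : ∀ t : Fin k, Integrable (fun ω => e t ω * e t ω / (2 * v t)) μ := fun t =>
    (h.integrable_mul (hem t) (hem t)).div_const _
  have i2 : ∀ t : Fin k, Integrable (fun ω => N t ω * N t ω / 2) μ := fun t =>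
    (h.integrable_mul (noise_mem_noiseSpan (Nat.lt_succ_self t))
      (noise_mem_noiseSpan (Nat.lt_succ_self t))).div_const _
  have i3 : ∀ t : Fin k, Integrable
      (fun ω => e t ω * e t ω / (2 * v t) - N t ω * N t ω / 2) μ := fun t => (i1 t).sub (i2 t)
  have i4 : ∀ t : Fin k, Integrable (fun ω => 1 / 2 * Real.log (v t) +
      (e t ω * e t ω / (2 * v t) - N t ω * N t ω / 2)) μ := fun t =>
    (integrable_const _).add (i3 t)
  have hpair : AEMeasurable (fun ω => (W ω, firstSamples Y k ω)) μ :=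
    (h.measurable_message.prodMk hYm).aemeasurable
  have key := klDiv_withDensity hf hgm (jointDensity_pos B) hg0
    (h.isRegularDensity_jointDensity hY).law hprod (by
      rw [integrable_map_measure hlm.aestronglyMeasurable hpair]
      simp only [Function.comp_def, hlog]
      exact integrable_finsetSum _ fun t _ => i4 t)
  refine ⟨key.1, key.2.trans ?_⟩
  rw [integral_map hpair hlm.aestronglyMeasurable]
  simp only [hlog]
  rw [integral_finsetSum _ fun t _ => i4 t, Finset.mul_sum]
  refine Finset.sum_congr rfl fun t _ => ?_
  rw [integral_add (integrable_const _) (i3 t), integral_sub (i1 t) (i2 t), integral_div,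
    integral_div, hv, h.integral_noise_sq]
  have := (hv0 t).ne'
  simp
  field_simp
  ring

end IsGaussianModel

end FeedbackCoding

namespace FeedbackCoding

/-- The mean-square error of the conditional mean of a linear functional, in terms of the
minimum mean-square error matrix. -/
theorem dotProduct_mmse_mulVec {Ω E ι : Type*} [MeasurableSpace Ω] [MeasurableSpace E] [Fintype ι]
    {μ : Measure Ω} [IsProbabilityMeasure μ] {X : Ω → ι → ℝ} {Y : Ω → E}
    (hX : ∀ i, MemLp (fun ω => X ω i) 2 μ) (a : ι → ℝ) :
    a ⬝ᵥ (mmse μ X Y *ᵥ a) = ∫ ω, (a ⬝ᵥ X ω - condMean μ (fun ω' => a ⬝ᵥ X ω') Y ω) ^ 2 ∂μ := by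
  have hXY : ∀ i, MemLp (fun ω => X ω i - condMean μ (fun ω' => X ω' i) Y ω) 2 μ := fun i =>
    (hX i).sub (MemLp.condExp one_le_two (hX i))
  have h1 := integral_sum_mul_sum (μ := μ)
    (X := fun i ω => X ω i - condMean μ (fun ω' => X ω' i) Y ω)
    (Y := fun i ω => X ω i - condMean μ (fun ω' => X ω' i) Y ω)
    (fun i j => (hXY i).integrable_mul (hXY j)) a a
  have h2 : condMean μ (fun ω' => a ⬝ᵥ X ω') Y =ᵐ[μ]
      fun ω => ∑ i, a i * condMean μ (fun ω' => X ω' i) Y ω := by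
    have h3 : (fun ω' => a ⬝ᵥ X ω') = ∑ i, a i • fun ω => X ω i := by
      funext ω
      simp [dotProduct]
    have h4 := condExp_finsetSum (μ := μ) (s := Finset.univ) (f := fun i => a i • fun ω => X ω i)
      (fun i _ => ((hX i).integrable one_le_two).smul (a i))
      (MeasurableSpace.comap Y inferInstance)
    have h5 : ∀ᵐ ω ∂μ, ∀ i, (μ[a i • fun ω => X ω i | MeasurableSpace.comap Y inferInstance]) ω =
        a i * condMean μ (fun ω' => X ω' i) Y ω := ae_all_iff.2 fun i => by
      filter_upwards [condExp_smul (μ := μ) (a i) (fun ω => X ω i)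
        (MeasurableSpace.comap Y inferInstance)] with ω hω
      rw [hω]
      rfl
    rw [condMean, h3]
    filter_upwards [h4, h5] with ω h6 h7
    rw [h6, Finset.sum_apply]
    exact Finset.sum_congr rfl fun i _ => h7 i
  have h8 : (fun ω => (a ⬝ᵥ X ω - condMean μ (fun ω' => a ⬝ᵥ X ω') Y ω) ^ 2) =ᵐ[μ] fun ω =>
      (∑ i, a i * (X ω i - condMean μ (fun ω' => X ω' i) Y ω)) *
        ∑ j, a j * (X ω j - condMean μ (fun ω' => X ω' j) Y ω) := by
    filter_upwards [h2] with ω hω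
    rw [hω, sq]
    simp only [dotProduct, mul_sub, Finset.sum_sub_distrib]
  rw [integral_congr_ae h8, h1]
  simp only [dotProduct, mulVec, Finset.mul_sum]
  refine Finset.sum_congr rfl fun i _ => Finset.sum_congr rfl fun j _ => ?_
  rw [mmse, of_apply]
  ring

end FeedbackCoding

/-! ### Assembly: information identities and optimality of the Kalman feedback -/

open FeedbackCoding in
theorem mainTheorem7 {Ω : Type*} [MeasurableSpace Ω] (μ : Measure Ω) [IsProbabilityMeasure μ]
    (n m T : ℕ) (S : Params n m)
    -- the message `W ∼ N(0, I)` and the independent white Gaussian channel noise `N`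
    (W : Ω → Fin (n + 1) → ℝ) (N : ℕ → Ω → ℝ)
    (hWmeas : Measurable W) (hNmeas : ∀ t, Measurable (N t))
    (hWlaw : μ.map W = Measure.pi fun _ => gaussianReal 0 1)
    (hNlaw : ∀ t, μ.map (N t) = gaussianReal 0 1)
    (hNindep : iIndepFun N μ)
    (hWN : IndepFun W (fun ω t => N t ω) μ)
    -- the signals: source `r` and observation `ybar` of the estimation system, then input `u`,
    -- output `y`, innovation `e` and estimation error `X` of the Kalman-filter coding system
    (r ybar u y e : ℕ → Ω → ℝ) (X : ℕ → Ω → Fin (n + 1) ⊕ Fin m → ℝ)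
    (hr : r = fun t ω => S.source (W ω) t)
    (hybar : ybar = fun t ω => S.openOutput (W ω) (fun τ => N τ ω) t)
    (hu : u = fun t ω => S.kalmanInput (W ω) (fun τ => N τ ω) t)
    (hy : y = fun t ω => S.kalmanOutput (W ω) (fun τ => N τ ω) t)
    (he : e = fun t ω => S.kalmanInnov (W ω) (fun τ => N τ ω) t)
    (hX : X = fun t ω => S.kalmanError (W ω) (fun τ => N τ ω) t)
    -- the joint law of `W` and the observations up to time `T`
    (ρ : Measure ((Fin (n + 1) → ℝ) × (Fin (T + 1) → ℝ)))
    (hρ : ρ = μ.map fun ω => (W ω, firstSamples ybar (T + 1) ω)) :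
    -- `ric` is the covariance of the estimation error
    (∀ t i j, ∫ ω, X t ω i * X t ω j ∂μ = S.ric t i j) ∧
    -- (i) mutual information; it does not depend on the feedback generator
    (mutualInfo μ W (firstSamples y (T + 1)) ≠ ⊤ ∧
      (∀ K : Matrix (Fin (T + 1)) (Fin (T + 1)) ℝ, IsStrictlyLower K →
        mutualInfo μ W (fun ω => S.fbOutput T K (W ω) (fun τ => N τ ω)) =
          mutualInfo μ W (firstSamples y (T + 1))) ∧
      (mutualInfo μ W (firstSamples y (T + 1))).toReal =
        1 / 2 * Real.log (covMatrix μ e T).det ∧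
      (mutualInfo μ W (firstSamples y (T + 1))).toReal =
        1 / 2 * ∑ t ∈ Finset.range (T + 1), Real.log (∫ ω, (e t ω) ^ 2 ∂μ) ∧
      (mutualInfo μ W (firstSamples y (T + 1))).toReal =
        1 / 2 * ∑ t ∈ Finset.range (T + 1),
          Real.log (S.bigC ⬝ᵥ (S.ric t *ᵥ S.bigC) + 1) ∧
      (mmse μ W (firstSamples ybar (T + 1))).PosDef ∧
      (mutualInfo μ W (firstSamples y (T + 1))).toReal =
        1 / 2 * Real.log ((mmse μ W (firstSamples ybar (T + 1)))⁻¹).det ∧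
      (∃ f, IsRegularDensity ρ f) ∧
      (∀ f, IsRegularDensity ρ f →
        (∀ i j, Integrable (fun z => score f i z * score f j z) ρ) ∧
        (bayesFisher ρ f).PosDef ∧
        (mutualInfo μ W (firstSamples y (T + 1))).toReal =
          1 / 2 * Real.log (bayesFisher ρ f).det ∧
        (mutualInfo μ W (firstSamples y (T + 1))).toReal =
          1 / 2 * Real.log ((bayesCRB ρ f)⁻¹).det)) ∧
    -- (ii) average channel input power under the optimal feedback generator
    (IsLeast {P : ℝ | ∃ K : Matrix (Fin (T + 1)) (Fin (T + 1)) ℝ, IsStrictlyLower K ∧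
        P = avgPower μ T (fun ω => S.fbInput T K (W ω) (fun τ => N τ ω))}
        (avgPower μ T (firstSamples u (T + 1))) ∧
      avgPower μ T (firstSamples u (T + 1)) =
        1 / ((T : ℝ) + 1) * ∑ t ∈ Finset.range (T + 1), S.bigD ⬝ᵥ (S.ric t *ᵥ S.bigD) ∧
      avgPower μ T (firstSamples u (T + 1)) =
        1 / ((T : ℝ) + 1) * (causalMmse μ r ybar T).trace ∧
      -- `W` is estimated from the observations at the times `0, …, t - 1`
      avgPower μ T (firstSamples u (T + 1)) =
        1 / ((T : ℝ) + 1) * ∑ t ∈ Finset.range (T + 1),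
          S.C ⬝ᵥ ((S.A ^ t * mmse μ W (firstSamples ybar t) * (S.A ^ t)ᵀ) *ᵥ S.C)) := by
  have h : IsGaussianModel μ W N := ⟨hWmeas, hNmeas, hWlaw, hNlaw, hNindep, hWN⟩
  have hX0 : ∀ ω, X 0 ω = Sum.elim (W ω) 0 := fun ω => by
    rw [hX]
    exact S.kalmanError_zero _ _
  have hXs : ∀ t ω, X (t + 1) ω = S.bigA *ᵥ X t ω - e t ω • S.gain t := fun t ω => by
    rw [hX, he]
    exact S.kalmanError_succ _ _ t
  have heX : ∀ t ω, e t ω = S.bigC ⬝ᵥ X t ω + N t ω := fun t ω => by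
    rw [hX, he]
    exact S.kalmanInnov_eq _ _ t
  have huX : ∀ t ω, u t ω = S.bigD ⬝ᵥ X t ω := fun t ω => by
    rw [hX, hu]
    exact S.kalmanInput_eq _ _ t
  have hY : ∀ ω (t : Fin (T + 1)), ybar t ω = (S.obsMatrix T *ᵥ W ω) t + N t ω := fun ω t => by
    rw [hybar]
    exact S.openOutput_eq_obsMatrix _ _ T t
  have hvpos := S.innovVar_pos h hX0 hXs heX
  have hee := S.integral_innov_sq h hX0 hXs heX
  have hcov := S.covMatrix_innov h hX0 hXs heX T
  have hpast := S.past_openOutput_eq W N hr hybar hu hy he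
  have hpast_le : ∀ t, past e t ≤ noiseSpan W N t := fun t => past_le_iff.2 fun s hs =>
    noiseSpan_mono hs (S.innov_mem_noiseSpan hX0 hXs heX s)
  have hum : ∀ t, u t ∈ noiseSpan W N t := fun t => by
    rw [funext (huX t)]
    exact S.dotProduct_error_mem hX0 hXs heX t _
  have huu : ∀ t, ∫ ω, u t ω * u t ω ∂μ = S.bigD ⬝ᵥ (S.ric t *ᵥ S.bigD) := fun t => by
    simp_rw [huX]
    exact S.integral_dotProduct_mul h hX0 hXs heX t _ _
  have huz : ∀ t, ∀ z ∈ past e t, ∫ ω, u t ω * z ω ∂μ = 0 := fun t z hz => by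
    simp_rw [huX]
    exact S.integral_dotProduct_mul_past h hX0 hXs heX t _ hz
  -- mutual information
  obtain ⟨M, hM, heM⟩ := exists_unitLower (k := T + 1) fun t _ =>
    S.innov_sub_openOutput_mem_past W N hr hybar hu hy he t
  obtain ⟨M', hM', hyM⟩ := exists_unitLower (k := T + 1) fun t _ =>
    S.output_sub_openOutput_mem_past W N hr hybar hu hy he t
  have hYmeas := h.measurable_firstSamples hY
  have hIy : mutualInfo μ W (firstSamples y (T + 1)) =
      mutualInfo μ W (firstSamples ybar (T + 1)) := by
    rw [funext hyM]
    exact mutualInfo_mulVec hWmeas hYmeas (by simp [hM'])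
  obtain ⟨hfin, hI⟩ := h.mutualInfo_of_whitening hY hM (e := fun t : Fin (T + 1) => e t) heM
    (fun t => hvpos t) (fun t => hee t) (S.law_innov h hX0 hXs heX (T + 1))
  rw [← hIy] at hfin hI
  have hlogdet : 1 / 2 * Real.log (1 + (S.obsMatrix T)ᵀ * S.obsMatrix T).det =
      1 / 2 * ∑ t : Fin (T + 1), Real.log (S.innovVar t) := by
    rw [h.det_eq_prod_of_whitening hY hM (e := fun t : Fin (T + 1) => e t)
      (v := fun t => S.innovVar t) heM fun i j => ?_, Real.log_prod fun (t : Fin (T + 1)) _ => (hvpos t).ne']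
    by_cases hij : i = j
    · subst hij
      rw [diagonal_apply_eq]
      exact hee i
    · rw [diagonal_apply_ne _ hij]
      exact S.integral_innov_mul_innov_of_ne h hX0 hXs heX fun hc => hij (Fin.ext hc)
  have hpd := IsGaussianModel.posDef_one_add (S.obsMatrix T)
  have hunit := hpd.det_pos.ne'.isUnit
  have hmmse := h.mmse_eq hY
  have hreg := h.isRegularDensity_jointDensity hY
  rw [← hρ] at hreg
  -- power
  have hcm : ∀ t, condMean μ (r t) (firstSamples ybar t) =ᵐ[μ] fun ω => r t ω - u t ω := fun t => by
    have hybm : ∀ j : Fin t, ybar j ∈ past e t := fun j => by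
      rw [← hpast]
      exact mem_past j.2
    have hru := S.source_sub_input_mem_past W N hr hu he t
    rw [← hpast] at hru
    exact condMean_ae_eq (fun j : Fin t => h.measurable (hpast_le t (hybm j)))
      (h.measurable (hum t)) (h.hasGaussianLaw_prod (X := fun _ : Fin 1 => u t) (fun _ => hum t)
        fun j => hpast_le t (hybm j)) (h.integral_eq_zero (hum t)) (fun j => huz t _ (hybm j))
      (exists_coeff_of_mem_past hru)
  have hpow : avgPower μ T (firstSamples u (T + 1)) =
      1 / ((T : ℝ) + 1) * ∑ t ∈ Finset.range (T + 1), S.bigD ⬝ᵥ (S.ric t *ᵥ S.bigD) := by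
    rw [avgPower, Finset.sum_range]
    congr 1
    refine Finset.sum_congr rfl fun t _ => ?_
    rw [← huu]
    simp_rw [sq]
    rfl
  have herr : ∀ t, ∫ ω, (r t ω - condMean μ (r t) (firstSamples ybar t) ω) ^ 2 ∂μ =
      S.bigD ⬝ᵥ (S.ric t *ᵥ S.bigD) := fun t => by
    rw [← huu]
    refine integral_congr_ae ?_
    filter_upwards [hcm t] with ω hω
    rw [hω]
    ring
  -- Pythagoras: the cross term vanishes by `huz`.
  have hlower : ∀ t, ∀ z ∈ past e t,
      ∫ ω, (u t ω) ^ 2 ∂μ ≤ ∫ ω, (u t ω + z ω) ^ 2 ∂μ := fun t z hz => by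
    have hzm := hpast_le t hz
    have h1 : ∀ ω, (u t ω + z ω) ^ 2 = u t ω * u t ω + (2 * (u t ω * z ω) + z ω * z ω) :=
      fun ω => by ring
    have i1 : Integrable (fun ω => 2 * (u t ω * z ω)) μ :=
      (h.integrable_mul (hum t) hzm).const_mul 2
    have i2 : Integrable (fun ω => 2 * (u t ω * z ω) + z ω * z ω) μ :=
      i1.add (h.integrable_mul hzm hzm)
    simp_rw [h1, sq]
    rw [integral_add (h.integrable_mul (hum t) (hum t)) i2,
      integral_add i1 (h.integrable_mul hzm hzm), integral_const_mul, huz t z hz]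
    have h2 : 0 ≤ ∫ ω, z ω * z ω ∂μ := integral_nonneg fun ω => mul_self_nonneg _
    linarith
  refine ⟨fun t i j => S.integral_error_mul_error h hX0 hXs heX t i j,
    ⟨hfin, fun K hK => ?_, ?_, ?_, ?_, ?_, ?_, ⟨_, hreg⟩, fun f hf => ?_⟩, ⟨?_, ?_⟩, hpow, ?_, ?_⟩
  · have hfb : (fun ω => S.fbOutput T K (W ω) (fun τ => N τ ω)) =
        fun ω => (1 - S.chanMatrix T * K)⁻¹ *ᵥ firstSamples ybar (T + 1) ω := by
      funext ω
      rw [S.fbOutput_eq, hybar]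
      rfl
    rw [hfb, hIy]
    refine mutualInfo_mulVec hWmeas hYmeas ?_
    simp [Matrix.det_nonsing_inv, (S.isStrictlyLower_chanMatrix_mul hK).det_one_sub]
  · rw [hI, hcov, Matrix.det_diagonal, Real.log_prod fun (t : Fin (T + 1)) _ => (hvpos t).ne']
  · rw [hI, Finset.sum_range]
    simp_rw [sq, hee]
  · rw [hI, Finset.sum_range]
    rfl
  · rw [hmmse]
    exact hpd.inv
  · rw [hmmse, Matrix.nonsing_inv_nonsing_inv _ hunit, hI, hlogdet]
  · obtain rfl := hf.unique hreg
    have hF : bayesFisher ρ (jointDensity (S.obsMatrix T)) =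
        1 + (S.obsMatrix T)ᵀ * S.obsMatrix T := by
      rw [hρ]
      exact h.bayesFisher_eq hY
    refine ⟨fun i j => ?_, hF ▸ hpd, ?_, ?_⟩
    · rw [hρ]
      exact (h.integrable_score_mul hY i j).1
    · rw [hI, hF, hlogdet]
    · rw [bayesCRB, hF, Matrix.nonsing_inv_nonsing_inv _ hunit, hI, hlogdet]
  · obtain ⟨K, hK, hKu⟩ := S.exists_fbInput_eq_kalmanInput W N hr hu hy he T
    exact ⟨K, hK, by rw [funext hKu]⟩
  · rintro P ⟨K, hK, rfl⟩
    refine mul_le_mul_of_nonneg_left (Finset.sum_le_sum fun t _ => ?_) (by positivity)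
    -- The competing input is `u t + z`, with `z` the sum of `r t - u t` and the feedback term.
    have hz := Submodule.add_mem _ (S.source_sub_input_mem_past W N hr hu he t)
      (hpast t ▸ S.fbInput_sub_source_mem_past W N hybar hK t)
    refine (hlower t _ hz).trans_eq (integral_congr_ae (ae_of_all _ fun ω => ?_))
    simp only [Pi.add_apply, Pi.sub_apply, hr]
    ring
  · rw [hpow, Finset.sum_range, Matrix.trace]
    congr 1
    refine Finset.sum_congr rfl fun t _ => ?_
    rw [← herr, Matrix.diag_apply, causalMmse, of_apply]
    simp_rw [sq]
  · rw [hpow]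
    congr 1
    refine Finset.sum_congr rfl fun t _ => ?_
    rw [← mulVec_mulVec, ← mulVec_mulVec, dotProduct_mulVec S.C, mulVec_transpose,
      dotProduct_mmse_mulVec fun i => h.memLp_two (message_mem_noiseSpan i 0), ← herr]
    have hrt : r t = fun ω => (S.C ᵥ* S.A ^ t) ⬝ᵥ W ω := by
      funext ω
      rw [hr]
      exact S.source_eq (W ω) t
    rw [hrt]
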